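/- Let $n,m\ge 1$ be integers, let $T_n$ be the space of symmetric complex $n\times n$ matrices and let $T_{n,m}=T_n\times\mathbb C^{(m,n)}$, where $\mathbb C^{(m,n)}$ is the space of complex $m\times n$ matrices. The unitary group $U(n)$ acts on $T_{n,m}$ by $h\cdot(w,z)=(h\,w\,{}^th,\;z\,{}^th)$. Regard $T_{n,m}$ as a real vector space, and let $\mathrm{Pol}_{n,m}$ be the $\mathbb C$-algebra of complex-valued polynomial functions on it (polynomials with complex coefficients in the real and imaginary parts of the entries of $w$ and $z$), and $\mathrm{Pol}_{n,m}^{U(n)}$ its subalgebra of $U(n)$-invariant elements. For $k\ge 0$ and $1\le a,b\le m$ put $$\varphi^{(2k)}(w,z)=\mathrm{tr}\big((w\bar w)^k\big),\qquad \psi^{(0,2k,0)}_{ba}=\big(\bar z(w\bar w)^k\,{}^tz\big)_{ba},$$ $$\psi^{(0,2k,1)}_{ba}=\big(\bar z(w\bar w)^k w\,{}^t\bar z\big)_{ba},\qquad \psi^{(1,2k,0)}_{ba}=\big(z\bar w(w\bar w)^k\,{}^tz\big)_{ba}.$$ Then: 1. The $\mathbb C$-algebra $\mathrm{Pol}_{n,m}^{U(n)}$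 is generated by the polynomials $\varphi^{(2k+2)}$, $\psi^{(0,2k,0)}_{ba}$, $\psi^{(0,2k,1)}_{ba}$ and $\psi^{(1,2k,0)}_{ba}$, where $0\le k\le n-1$ and $1\le a,b\le m$. 2. The $\mathbb C$-algebra $\mathrm{Pol}_{n,m}^{U(n)}$ is also generated by the real-valued polynomials $\varphi^{(2k+2)}$, $\mathrm{Re}\,\psi^{(0,2k,0)}_{ab}$, $\mathrm{Im}\,\psi^{(0,2k,0)}_{cd}$, $\mathrm{Re}\,\psi^{(1,2k,0)}_{ab}$ and $\mathrm{Im}\,\psi^{(1,2k,0)}_{ab}$, where $0\le k\le n-1$, $1\le a\le b\le m$ and $1\le c<d\le m$. Moreover, these same polynomials generate, as an $\mathbb R$-algebra, the algebra of real-valued $U(n)$-invariant polynomial functions on $T_{n,m}$. -/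

import Mathlib

open Matrix

noncomputable section

namespace SiegelJacobi

/-- The entrywise complex conjugate of a complex matrix. -/
def bar {p q : Type*} (A : Matrix p q ℂ) : Matrix p q ℂ := A.map (starRingEnd ℂ)

/-- The complex vector space `T_n` of symmetric complex `n × n` matrices. -/
def SymMat (n : ℕ) : Submodule ℂ (Matrix (Fin n) (Fin n) ℂ) where
  carrier := {A | Aᵀ = A}
  add_mem' := by
    intro A B hA hB
    change Aᵀ = A at hA; change Bᵀ = B at hB; change (A + B)ᵀ = A + B
    rw [transpose_add, hA, hB]
  zero_mem' := transpose_zero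
  smul_mem' := by
    intro c A hA
    change Aᵀ = A at hA; change (c • A)ᵀ = c • A
    rw [transpose_smul, hA]

/-- The space `T_{n,m} = T_n × ℂ^{(m,n)}`. It is used below as a real vector space. -/
abbrev T (n m : ℕ) : Type := SymMat n × Matrix (Fin m) (Fin n) ℂ

/-- The natural action of `U(n)` on `T_{n,m}`: `h · (w, z) = (h w ᵗh, z ᵗh)`. -/
def act {n m : ℕ} (h : Matrix.unitaryGroup (Fin n) ℂ) (x : T n m) : T n m :=
  (⟨(h : Matrix (Fin n) (Fin n) ℂ) * (x.1 : Matrix (Fin n) (Fin n) ℂ) *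
      (h : Matrix (Fin n) (Fin n) ℂ)ᵀ, by
      have hx : (x.1 : Matrix (Fin n) (Fin n) ℂ)ᵀ = x.1 := x.1.2
      change (_ * _ * _)ᵀ = _
      rw [transpose_mul, transpose_mul, transpose_transpose, hx, Matrix.mul_assoc]⟩,
    x.2 * (h : Matrix (Fin n) (Fin n) ℂ)ᵀ)

/-- The algebra of `𝕜`-valued polynomial functions on a real vector space `V` (for `𝕜 = ℝ` or
`𝕜 = ℂ`): the `𝕜`-algebra of functions generated by the `ℝ`-linear maps `V → 𝕜`. -/
def Pol (𝕜 : Type*) [RCLike 𝕜] (V : Type*) [AddCommGroup V] [Module ℝ V] :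
    Subalgebra 𝕜 (V → 𝕜) :=
  Algebra.adjoin 𝕜 {f | ∃ l : V →ₗ[ℝ] 𝕜, f = l}

/-- The algebra of `U(n)`-invariant `𝕜`-valued polynomial functions on the real vector space
`T_{n,m}`. -/
def PolInv (𝕜 : Type*) [RCLike 𝕜] (n m : ℕ) : Subalgebra 𝕜 (T n m → 𝕜) where
  carrier := {P | P ∈ Pol 𝕜 (T n m) ∧
    ∀ (h : Matrix.unitaryGroup (Fin n) ℂ) (x : T n m), P (act h x) = P x}
  mul_mem' := by
    rintro P Q ⟨hP, hP'⟩ ⟨hQ, hQ'⟩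
    exact ⟨mul_mem hP hQ, fun h x => by simp only [Pi.mul_apply, hP', hQ']⟩
  add_mem' := by
    rintro P Q ⟨hP, hP'⟩ ⟨hQ, hQ'⟩
    exact ⟨add_mem hP hQ, fun h x => by simp only [Pi.add_apply, hP', hQ']⟩
  algebraMap_mem' := fun r => ⟨Subalgebra.algebraMap_mem _ r, fun _ _ => rfl⟩

/-- `phi k = φ^{(2k)} : (w, z) ↦ tr ((w w̄)^k)`. -/
def phi {n m : ℕ} (k : ℕ) (x : T n m) : ℂ :=
  Matrix.trace (((x.1 : Matrix (Fin n) (Fin n) ℂ) * bar (x.1 : Matrix (Fin n) (Fin n) ℂ)) ^ k)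

/-- `psi00 k b a = ψ^{(0,2k,0)}_{ba} : (w, z) ↦ (z̄ (w w̄)^k ᵗz)_{ba}`. -/
def psi00 {n m : ℕ} (k : ℕ) (b a : Fin m) (x : T n m) : ℂ :=
  (bar x.2 * ((x.1 : Matrix (Fin n) (Fin n) ℂ) * bar (x.1 : Matrix (Fin n) (Fin n) ℂ)) ^ k *
    x.2ᵀ) b a

/-- `psi01 k b a = ψ^{(0,2k,1)}_{ba} : (w, z) ↦ (z̄ (w w̄)^k w ᵗz̄)_{ba}`. -/
def psi01 {n m : ℕ} (k : ℕ) (b a : Fin m) (x : T n m) : ℂ :=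
  (bar x.2 * ((x.1 : Matrix (Fin n) (Fin n) ℂ) * bar (x.1 : Matrix (Fin n) (Fin n) ℂ)) ^ k *
    (x.1 : Matrix (Fin n) (Fin n) ℂ) * (bar x.2)ᵀ) b a

/-- `psi10 k b a = ψ^{(1,2k,0)}_{ba} : (w, z) ↦ (z w̄ (w w̄)^k ᵗz)_{ba}`. -/
def psi10 {n m : ℕ} (k : ℕ) (b a : Fin m) (x : T n m) : ℂ :=
  (x.2 * bar (x.1 : Matrix (Fin n) (Fin n) ℂ) *
    ((x.1 : Matrix (Fin n) (Fin n) ℂ) * bar (x.1 : Matrix (Fin n) (Fin n) ℂ)) ^ k * x.2ᵀ) b a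

/-- The function `φ^{(2k)}` is real-valued. -/
theorem phi_im {n m : ℕ} (k : ℕ) (x : T n m) : (phi k x).im = 0 := by
  have hx : (x.1 : Matrix (Fin n) (Fin n) ℂ)ᵀ = x.1 := x.1.2
  apply Complex.conj_eq_iff_im.mp
  unfold phi bar
  generalize (x.1 : Matrix (Fin n) (Fin n) ℂ) = w at hx ⊢
  have hb : (w.map (starRingEnd ℂ)).map (starRingEnd ℂ) = w := by
    ext i j; simp
  rw [AddMonoidHom.map_trace (starRingEnd ℂ)]
  change ((starRingEnd ℂ).mapMatrix ((w * w.map (starRingEnd ℂ)) ^ k)).trace = _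
  rw [map_pow, RingHom.mapMatrix_apply, Matrix.map_mul, hb, ← Matrix.trace_transpose,
    Matrix.transpose_pow, Matrix.transpose_mul, ← Matrix.transpose_map, hx]

/-- The generating family `φ^{(2k+2)}`, `ψ^{(0,2k,0)}_{ba}`, `ψ^{(0,2k,1)}_{ba}`,
`ψ^{(1,2k,0)}_{ba}` with `0 ≤ k ≤ n - 1` and `1 ≤ a, b ≤ m`. -/
def complexGenerators (n m : ℕ) : Set (T n m → ℂ) :=
  {f | ∃ k < n, f = phi (k + 1)} ∪
  {f | ∃ k < n, ∃ a b : Fin m, f = psi00 k b a} ∪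
  {f | ∃ k < n, ∃ a b : Fin m, f = psi01 k b a} ∪
  {f | ∃ k < n, ∃ a b : Fin m, f = psi10 k b a}

/-- The generating family of real-valued functions `φ^{(2k+2)}`, `Re ψ^{(0,2k,0)}_{ab}`,
`Im ψ^{(0,2k,0)}_{cd}`, `Re ψ^{(1,2k,0)}_{ab}`, `Im ψ^{(1,2k,0)}_{ab}` with `0 ≤ k ≤ n - 1`,
`1 ≤ a ≤ b ≤ m` and `1 ≤ c < d ≤ m`. The function `φ^{(2k+2)}` is real-valued by `phi_im`. -/
def realGenerators (n m : ℕ) : Set (T n m → ℝ) :=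
  {f | ∃ k < n, f = fun x => (phi (k + 1) x).re} ∪
  {f | ∃ k < n, ∃ a b : Fin m, a ≤ b ∧ f = fun x => (psi00 k a b x).re} ∪
  {f | ∃ k < n, ∃ c d : Fin m, c < d ∧ f = fun x => (psi00 k c d x).im} ∪
  {f | ∃ k < n, ∃ a b : Fin m, a ≤ b ∧ f = fun x => (psi10 k a b x).re} ∪
  {f | ∃ k < n, ∃ a b : Fin m, a ≤ b ∧ f = fun x => (psi10 k a b x).im}

end SiegelJacobi

end

/-! The core is the first fundamental theorem for `U(n)`, applied to monomials in the entries of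
`w`, `w̄`, `z`, `z̄`. An invariant polynomial is a combination of such monomials. Its coefficients
are not unique, but the coefficient space carries a unitary action, and `exists_invariant_preimage`
replaces them by invariant ones. The coefficients of each word of coordinate types then form an
invariant tensor, and by `invariant_tensor_mem_span` such a tensor is a combination of matchings
between indices moved by `h` and indices moved by `h̄`. This rests on Schur–Weyl duality
(`exists_perm_of_tens_commute`), which is derived from polarization and the density theorem.

Contracting a monomial along a matching glues its factors into chains in which `w` and `w̄`
alternate. A closed chain is a trace `φ`; an open chain ends in rows of `z` or `z̄` and is one of
the `ψ`. So the invariants are generated by all `φ` and `ψ` with unbounded exponent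
(`PolInv_le_fullAlg`).

The exponent is bounded by Cayley–Hamilton for `w w̄`: the powers satisfy a linear recurrence of
length `n` whose coefficients are, by Newton's identities, polynomials in `φ^{(2)}, …, φ^{(2n)}`.
The real statements follow by taking real and imaginary parts, using that the matrix `ψ^{(0,2k,0)}`
is Hermitian, that `ψ^{(1,2k,0)}` is symmetric, and that `ψ^{(0,2k,1)}` is its conjugate. -/

noncomputable section

namespace SiegelJacobi

/-! ### Schur–Weyl duality for tensor powers of matrices. -/

section Tensor

variable {S ι : Type*} [Fintype S] [DecidableEq S] [Fintype ι] [DecidableEq ι]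

/-- The square-free part of a polynomial identity: the sum of the coefficients attached to
permutations vanishes. -/
theorem sum_perm_eq_zero (a : (S → S) → ℂ)
    (h : ∀ t : S → ℂ, ∑ f, a f * ∏ s, t (f s) = 0) : ∑ σ : Equiv.Perm S, a σ = 0 := by
  classical
  let Q : MvPolynomial S ℂ := ∑ f : S → S, MvPolynomial.C (a f) * ∏ s, MvPolynomial.X (f s)
  have hQ : Q = 0 := by
    apply MvPolynomial.funext
    intro t
    simpa [Q, MvPolynomial.eval_sum, MvPolynomial.eval_prod] using h t
  have hX : ∀ f : S → S, (∏ s, MvPolynomial.X (f s) : MvPolynomial S ℂ) =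
      MvPolynomial.monomial (∑ s, Finsupp.single (f s) 1) 1 := by
    intro f
    rw [MvPolynomial.monomial_sum_one]
    rfl
  -- Read off the coefficient of the squarefree monomial `∏ X_s`; a map `f` contributes to it
  -- exactly when it is bijective.
  have hc := congrArg (MvPolynomial.coeff (∑ s : S, Finsupp.single s 1)) hQ
  have hbij : ∀ f : S → S, (∑ s, Finsupp.single (f s) 1 : S →₀ ℕ) = ∑ s, Finsupp.single s 1 ↔
      Function.Bijective f := by
    intro f
    constructor
    · intro e
      rw [← Finite.surjective_iff_bijective]
      intro y
      have := DFunLike.congr_fun e y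
      by_contra hy
      push Not at hy
      simp [Finsupp.finsetSum_apply, Finsupp.single_apply, hy] at this
    · intro hf
      exact Function.Bijective.sum_comp hf (fun s => (Finsupp.single s 1 : S →₀ ℕ))
  simp only [Q, MvPolynomial.coeff_sum, MvPolynomial.coeff_C_mul, hX, MvPolynomial.coeff_monomial,
    hbij, MvPolynomial.coeff_zero, mul_ite, mul_one, mul_zero] at hc
  rw [← hc, ← Finset.sum_filter]
  refine Finset.sum_bij (fun σ _ => (σ : S → S)) ?_ ?_ ?_ ?_
  · intro σ _; simp
  · intro σ _ τ _ h; exact DFunLike.coe_injective h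
  · intro f hf; exact ⟨Equiv.ofBijective f (by simpa using hf), by simp, rfl⟩
  · intro _ _; rfl

variable (S) in
/-- The matrix of the tensor power of `g` indexed by `S`. -/
def tens (g : Matrix ι ι ℂ) : Matrix (S → ι) (S → ι) ℂ := of fun I J => ∏ s, g (I s) (J s)

omit [DecidableEq S] [Fintype ι] [DecidableEq ι] in
theorem tens_apply (g : Matrix ι ι ℂ) (I J : S → ι) : tens S g I J = ∏ s, g (I s) (J s) := rfl

omit [DecidableEq ι] in
theorem tens_mul (g h : Matrix ι ι ℂ) : tens S (g * h) = tens S g * tens S h := by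
  ext I J
  simp only [tens_apply, Matrix.mul_apply, Finset.prod_univ_sum, Fintype.piFinset_univ,
    Finset.prod_mul_distrib]

omit [DecidableEq S] [Fintype ι] in
theorem tens_diagonal (d : ι → ℂ) : tens S (diagonal d) = diagonal fun I => ∏ s, d (I s) := by
  ext I J
  rw [tens_apply]
  by_cases h : I = J
  · subst h; simp
  · obtain ⟨s, hs⟩ := Function.ne_iff.mp h
    rw [diagonal_apply_ne _ h]
    exact Finset.prod_eq_zero (Finset.mem_univ s) (diagonal_apply_ne _ hs)

theorem exists_norm_eq_one_pow_ne {a b : ℕ} (hab : a ≠ b) :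
    ∃ ζ : ℂ, star ζ * ζ = 1 ∧ ζ ^ a ≠ ζ ^ b := by
  have hab' : (a : ℂ) - b ≠ 0 := sub_ne_zero.mpr (by exact_mod_cast hab)
  let θ : ℝ := Real.pi / (a - b)
  have hζ : Complex.exp (θ * Complex.I) ≠ 0 := Complex.exp_ne_zero _
  refine ⟨Complex.exp (θ * Complex.I), ?_, ?_⟩
  · have := Complex.norm_exp_ofReal_mul_I θ
    rw [Complex.star_def, ← Complex.normSq_eq_conj_mul_self, Complex.normSq_eq_norm_sq, this]
    simp
  · have key : Complex.exp (θ * Complex.I) ^ a = Complex.exp (θ * Complex.I) ^ b * -1 := by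
      rw [← Complex.exp_pi_mul_I, ← Complex.exp_nat_mul, ← Complex.exp_nat_mul, ← Complex.exp_add]
      congr 1
      simp only [θ]
      push_cast
      field_simp
      ring
    rw [key]
    intro h
    have h2 : Complex.exp (θ * Complex.I) ^ b * 2 = 0 := by linear_combination -h
    simp [hζ] at h2

/-- If `C I J ≠ 0`, unit-modulus diagonal matrices force `∏ d (I s) = ∏ d (J s)`. Varying one entry
of `d` on the circle shows that `I` and `J` take each value equally often, so the products agree for
every `d`. -/
theorem tens_commute_diagonal {C : Matrix (S → ι) (S → ι) ℂ}
    (hC : ∀ h ∈ unitaryGroup ι ℂ, Commute C (tens S h)) (d : ι → ℂ) :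
    Commute C (tens S (diagonal d)) := by
  classical
  rw [tens_diagonal]
  ext I J
  rw [mul_diagonal, diagonal_mul, mul_comm]
  by_cases h0 : C I J = 0
  · simp [h0]
  congr 1
  have hd : ∀ d : ι → ℂ, (∀ i, star (d i) * d i = 1) → ∏ s, d (J s) = ∏ s, d (I s) := by
    intro d hd
    have := congrFun (congrFun (hC (diagonal d) (by
      rw [mem_unitaryGroup_iff', star_eq_conjTranspose, diagonal_conjTranspose,
        diagonal_mul_diagonal, ← diagonal_one]
      congr 1; ext i; exact hd i)).eq I) J
    rw [tens_diagonal, mul_diagonal, diagonal_mul, mul_comm] at this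
    exact mul_right_cancel₀ h0 this
  have hcomp : ∀ (d : ι → ℂ) (I : S → ι),
      ∏ s, d (I s) = ∏ i, d i ^ (Finset.univ.filter fun s => I s = i).card := by
    intro d I
    rw [← Finset.prod_fiberwise (s := Finset.univ) (g := I)]
    refine Finset.prod_congr rfl fun i _ => ?_
    rw [Finset.prod_congr rfl (g := fun _ => d i) (by intro s hs; simp at hs; rw [hs]),
      Finset.prod_const]
  have hcard : ∀ i, (Finset.univ.filter fun s => J s = i).card =
      (Finset.univ.filter fun s => I s = i).card := by
    intro i
    by_contra hne
    obtain ⟨ζ, hζ, hζ'⟩ := exists_norm_eq_one_pow_ne hne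
    apply hζ'
    have := hd (Function.update 1 i ζ) (by
      intro j; by_cases hj : j = i
      · subst hj; simpa using hζ
      · simp [hj])
    rw [hcomp, hcomp] at this
    have aux : ∀ c : ι → ℕ, ∏ j, Function.update (1 : ι → ℂ) i ζ j ^ c j = ζ ^ c i := by
      intro c
      rw [Finset.prod_eq_single i] <;> simp +contextual [Function.update_of_ne]
    rwa [aux, aux] at this
  rw [hcomp, hcomp]
  simp [hcard]

theorem tens_commute_isHermitian {C : Matrix (S → ι) (S → ι) ℂ}
    (hC : ∀ h ∈ unitaryGroup ι ℂ, Commute C (tens S h)) {A : Matrix ι ι ℂ} (hA : A.IsHermitian) :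
    Commute C (tens S A) := by
  rw [hA.spectral_theorem, Unitary.conjStarAlgAut_apply, tens_mul, tens_mul]
  exact ((hC _ hA.eigenvectorUnitary.2).mul_right (tens_commute_diagonal hC _)).mul_right
    (hC _ (star hA.eigenvectorUnitary).2)

/-- Unitarian trick: write `g = A + iB` with `A`, `B` Hermitian. Each entry of the commutator with
the tensor power of `A + tB` is a polynomial in `t` vanishing at all real `t`, hence also at `t =
i`. -/
theorem tens_commute {C : Matrix (S → ι) (S → ι) ℂ}
    (hC : ∀ h ∈ unitaryGroup ι ℂ, Commute C (tens S h)) (g : Matrix ι ι ℂ) :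
    Commute C (tens S g) := by
  obtain ⟨A, B, hA, hB, rfl⟩ : ∃ A B : Matrix ι ι ℂ, A.IsHermitian ∧ B.IsHermitian ∧
      g = A + Complex.I • B := by
    refine ⟨realPart g, imaginaryPart g, (realPart g).2, (imaginaryPart g).2, ?_⟩
    exact (realPart_add_I_smul_imaginaryPart g).symm
  ext I J
  let q : Polynomial ℂ := ∑ L, Polynomial.C (C I L) *
      ∏ s, (Polynomial.C (A (L s) (J s)) + Polynomial.X * Polynomial.C (B (L s) (J s))) -
    ∑ L, (∏ s, (Polynomial.C (A (I s) (L s)) + Polynomial.X * Polynomial.C (B (I s) (L s)))) *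
      Polynomial.C (C L J)
  have hq : ∀ t : ℂ, q.eval t =
      (C * tens S (A + t • B)) I J - (tens S (A + t • B) * C) I J := by
    intro t
    simp [q, Polynomial.eval_finsetSum, Polynomial.eval_prod, Matrix.mul_apply,
      tens_apply, mul_comm t]
  have h0 : q = 0 := by
    apply Polynomial.eq_zero_of_infinite_isRoot
    refine Set.Infinite.mono ?_ (Set.infinite_range_of_injective Complex.ofReal_injective)
    rintro _ ⟨t, rfl⟩
    have hH : (A + (t : ℂ) • B).IsHermitian := hA.add (by
      rw [IsHermitian, conjTranspose_smul, hB.eq]; simp)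
    change q.eval _ = 0
    rw [hq, (tens_commute_isHermitian hC hH).eq, sub_self]
  exact sub_eq_zero.mp (by rw [← hq, h0, Polynomial.eval_zero])

/-- **Polarization** of the relation `C g^{⊗S} = g^{⊗S} C`. -/
theorem sum_perm_of_tens_commute {C : Matrix (S → ι) (S → ι) ℂ}
    (hC : ∀ g, Commute C (tens S g)) (a b I J : S → ι) :
    ∑ σ : Equiv.Perm S, C I (a ∘ σ) * (if b ∘ σ = J then 1 else 0) =
      ∑ σ : Equiv.Perm S, (if a ∘ σ = I then 1 else 0) * C (b ∘ σ) J := by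
  rw [← sub_eq_zero, ← Finset.sum_sub_distrib]
  -- Test commutation on `g = ∑ t_k E_{a_k b_k}`. Its tensor power expands into one term for each
  -- map `f : S → S`, and the squarefree part in `t` keeps only the permutations.
  refine sum_perm_eq_zero (fun f => C I (a ∘ f) * (if b ∘ f = J then 1 else 0) -
    (if a ∘ f = I then 1 else 0) * C (b ∘ f) J) fun t => ?_
  have ht : ∀ I J : S → ι, tens S (∑ k, t k • Matrix.single (a k) (b k) (1 : ℂ)) I J =
      ∑ f : S → S, (∏ s, t (f s)) * ((if a ∘ f = I then 1 else 0) * if b ∘ f = J then 1 else 0) :=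
      by
    intro I J
    simp only [tens_apply, Matrix.sum_apply, Matrix.smul_apply, Finset.prod_univ_sum,
      Fintype.piFinset_univ, smul_eq_mul, Finset.prod_mul_distrib]
    refine Finset.sum_congr rfl fun f _ => ?_
    congr 1
    simp only [Matrix.single_apply, funext_iff, Function.comp_apply, ← ite_and, mul_ite,
      mul_one, mul_zero]
    by_cases h : (∀ s, b (f s) = J s) ∧ ∀ s, a (f s) = I s
    · simp [h.1, h.2]
    · rw [if_neg h]
      have : ∃ s, ¬ (a (f s) = I s ∧ b (f s) = J s) := by
        by_contra hn; push Not at hn; exact h ⟨fun s => (hn s).2, fun s => (hn s).1⟩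
      obtain ⟨s, hs⟩ := this
      exact Finset.prod_eq_zero (Finset.mem_univ s) (if_neg hs)
  have h := congrFun (congrFun (hC (∑ k, t k • Matrix.single (a k) (b k) (1 : ℂ))).eq I) J
  rw [← sub_eq_zero, Matrix.mul_apply, Matrix.mul_apply] at h
  refine Eq.trans ?_ h
  simp only [ht, Finset.mul_sum, Finset.sum_mul]
  rw [Finset.sum_comm, Finset.sum_comm (γ := S → ι), ← Finset.sum_sub_distrib]
  refine Finset.sum_congr rfl fun f _ => ?_
  rw [Finset.sum_eq_single (a ∘ f), Finset.sum_eq_single (b ∘ f)]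
  · rw [if_pos rfl, if_pos rfl]
    ring
  · intro L _ hL; simp [hL.symm]
  · simp
  · intro L _ hL; simp [hL.symm]
  · simp

/-- The permutation representation on tensors. -/
def permRep (S ι : Type*) : Representation ℂ (Equiv.Perm S) ((S → ι) → ℂ) where
  toFun σ := LinearMap.funLeft ℂ ℂ fun I => I ∘ σ
  map_one' := rfl
  map_mul' _ _ := rfl

omit [Fintype S] [DecidableEq S] [Fintype ι] [DecidableEq ι] in
theorem permRep_apply (σ : Equiv.Perm S) (v : (S → ι) → ℂ) (I : S → ι) :
    permRep S ι σ v I = v (I ∘ σ) := rfl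

/-- **Schur–Weyl duality**: a matrix commuting with all tensor powers is a combination of
permutations. -/
theorem exists_perm_of_tens_commute {C : Matrix (S → ι) (S → ι) ℂ}
    (hC : ∀ g, Commute C (tens S g)) :
    ∃ r : Equiv.Perm S → ℂ, ∀ I J, C I J = ∑ σ, r σ * if I ∘ σ = J then 1 else 0 := by
  let ρ := permRep S ι
  let R := MonoidAlgebra ℂ (Equiv.Perm S)
  let M := ρ.asModule
  have hρ : ∀ (r : R) (v : (S → ι) → ℂ) (I : S → ι),
      ρ.asAlgebraHom r v I = ∑ σ, r.coeff σ * v (I ∘ σ) := by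
    intro r v I
    rw [Representation.asAlgebraHom_def, MonoidAlgebra.lift_apply, Finsupp.sum_fintype]
    · simp [ρ, permRep_apply, LinearMap.sum_apply]
    · simp
  let e := ρ.asModuleEquiv
  -- The hypothesis of the density theorem: `C` commutes with every endomorphism of tensor space
  -- that commutes with the permutations.
  have key : ∀ (φ : Module.End R M) (v : M),
      C.mulVecLin (e (φ v)) = e (φ (e.symm (C.mulVecLin (e v)))) := by
    intro φ v
    have hφr : ∀ (r : R) (v : (S → ι) → ℂ), e (φ (e.symm (ρ.asAlgebraHom r v))) =
        ρ.asAlgebraHom r (e (φ (e.symm v))) := by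
      intro r v
      have := map_smul φ r (e.symm v)
      rw [← ρ.asModuleEquiv_map_smul, ← this]
      rfl
    let φ' : ((S → ι) → ℂ) →ₗ[ℂ] ((S → ι) → ℂ) :=
      { toFun := fun v => e (φ (e.symm v))
        map_add' := fun v w => by simp only [map_add]
        map_smul' := fun c v => by
          have := hφr (algebraMap ℂ R c) v
          rw [(ρ.asAlgebraHom).commutes c] at this
          exact this }
    have hφ : ∀ (σ : Equiv.Perm S) (v : (S → ι) → ℂ), φ' (ρ σ v) = ρ σ (φ' v) := by
      intro σ v
      have := hφr (MonoidAlgebra.of ℂ _ σ) v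
      rw [Representation.asAlgebraHom_of] at this
      exact this
    let X := LinearMap.toMatrix' φ'
    have hX : ∀ (σ : Equiv.Perm S) (a b : S → ι), X (a ∘ σ) (b ∘ σ) = X a b := by
      intro σ a b
      have h := congrFun (hφ σ (Pi.single (b ∘ σ) 1)) a
      rw [permRep_apply] at h
      have hs : ρ σ (Pi.single (b ∘ σ) 1) = Pi.single b 1 := by
        ext I
        rw [permRep_apply, Pi.single_apply, Pi.single_apply]
        congr 1
        exact propext (σ.surjective.injective_comp_right.eq_iff)
      rw [hs] at h
      simpa [X, LinearMap.toMatrix'_apply] using h.symm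
    -- Pair the polarized relation with the entries of `X`. Since `X` is invariant under
    -- simultaneous permutation, all permutations contribute equally, and the number of permutations
    -- can be cancelled.
    have hCX : C * X = X * C := by
      ext I J
      have h : ∑ a, ∑ b, X a b * ∑ σ : Equiv.Perm S, C I (a ∘ σ) * (if b ∘ σ = J then 1 else 0) =
          ∑ a, ∑ b, X a b * ∑ σ : Equiv.Perm S, (if a ∘ σ = I then 1 else 0) * C (b ∘ σ) J := by
        simp only [sum_perm_of_tens_commute hC]
      have hre : ∀ G : (S → ι) → (S → ι) → ℂ,
          ∑ a, ∑ b, X a b * ∑ σ : Equiv.Perm S, G (a ∘ σ) (b ∘ σ) =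
          (Fintype.card (Equiv.Perm S) : ℂ) * ∑ a, ∑ b, X a b * G a b := by
        intro G
        simp only [Finset.mul_sum]
        rw [Finset.sum_congr rfl fun a _ => Finset.sum_comm, Finset.sum_comm]
        have : ∀ σ : Equiv.Perm S, ∑ a, ∑ b, X a b * G (a ∘ σ) (b ∘ σ) =
            ∑ a, ∑ b, X a b * G a b := by
          intro σ
          have hb : Function.Bijective fun a : S → ι => a ∘ σ :=
            (Equiv.arrowCongr σ.symm (Equiv.refl ι)).bijective
          rw [← hb.sum_comp (fun a => ∑ b, X a b * G a b)]
          refine Finset.sum_congr rfl fun a _ => ?_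
          rw [← hb.sum_comp (fun b => X _ b * G _ b)]
          simp only [hX]
        simp only [this, Finset.sum_const, nsmul_eq_mul, Finset.card_univ, Finset.mul_sum]
      rw [hre fun a b => C I a * if b = J then 1 else 0,
        hre fun a b => (if a = I then 1 else 0) * C b J] at h
      have h' := mul_left_cancel₀ (by exact_mod_cast Fintype.card_ne_zero) h
      simp only [mul_ite, mul_one, mul_zero, Finset.sum_ite_eq', Finset.mem_univ,
        if_true, ite_mul, one_mul, zero_mul] at h'
      rw [Finset.sum_comm (f := fun a b => if a = I then X a b * C b J else 0)] at h'
      simp only [Finset.sum_ite_eq', Finset.mem_univ, if_true] at h'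
      rw [Matrix.mul_apply, Matrix.mul_apply, ← h']
      exact Finset.sum_congr rfl fun a _ => mul_comm _ _
    have hφX : ∀ v, φ' v = X *ᵥ v := fun v => by
      rw [← Matrix.toLin'_apply]; simp [X]
    change C *ᵥ (φ' (e v)) = φ' (C *ᵥ (e v))
    rw [hφX, hφX, mulVec_mulVec, mulVec_mulVec, hCX]
  let f : Module.End (Module.End R M) M :=
    { toFun := fun v => e.symm (C.mulVecLin (e v))
      map_add' := fun v w => by simp only [map_add]
      map_smul' := fun φ v => by
        rw [Module.End.smul_def, key]
        rfl }
  classical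
  -- Tensor space is semisimple over the group algebra, so `C` agrees with an element of that
  -- algebra on any finite set; the standard basis is such a set.
  obtain ⟨r, hr⟩ := jacobson_density f
    (Finset.univ.image fun J : S → ι => e.symm (Pi.single J 1 : (S → ι) → ℂ))
  refine ⟨r.coeff, fun I J => ?_⟩
  have h : C *ᵥ Pi.single J 1 = ρ.asAlgebraHom r (Pi.single J 1) :=
    congrArg e (hr (e.symm (Pi.single J 1)) (Finset.mem_image_of_mem _ (Finset.mem_univ J)))
  have h2 := congrFun h I
  rw [hρ] at h2
  simpa [Pi.single_apply] using h2

end Tensor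

/-! ### Invariant tensors of the unitary group. -/

section InvariantTensor

variable {S ι : Type*} [Fintype S] [DecidableEq S] [Fintype ι] [DecidableEq ι]

omit [DecidableEq S] [Fintype ι] in
theorem tens_one : tens S (1 : Matrix ι ι ℂ) = 1 := by
  rw [← diagonal_one, tens_diagonal]
  simp

omit [DecidableEq S] [Fintype ι] [DecidableEq ι] in
theorem tens_transpose (g : Matrix ι ι ℂ) : tens S gᵀ = (tens S g)ᵀ := rfl

/-- The action of a matrix on a slot: slots of kind `true` transform by `h`, the others by `h̄`. -/
def slotMat (b : Bool) (h : Matrix ι ι ℂ) : Matrix ι ι ℂ := if b then h else bar h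

theorem bar_mem_unitaryGroup {h : Matrix ι ι ℂ} (hh : h ∈ unitaryGroup ι ℂ) :
    bar h ∈ unitaryGroup ι ℂ := by
  rw [mem_unitaryGroup_iff] at hh ⊢
  have := congrArg (starRingEnd ℂ).mapMatrix hh
  rw [map_mul, map_one] at this
  exact this

/-- The elementary invariant tensor attached to a matching of the slots of both kinds. -/
def matchTensor (κ : S → Bool) (σ : {s // κ s = true} ≃ {s // ¬ κ s = true}) (I : S → ι) : ℂ :=
  if ∀ s : {s // κ s = true}, I s = I (σ s) then 1 else 0

/-- A scalar matrix `ζ` with `|ζ| = 1` multiplies the tensor by `ζ^p ζ̄^q`, where `p` and `q` count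
the slots of the two kinds. If `p ≠ q`, some `ζ` makes this factor different from `1`. -/
theorem invariant_tensor_eq_zero (κ : S → Bool) (C : (S → ι) → ℂ)
    (hC : ∀ h ∈ unitaryGroup ι ℂ, ∀ J, ∑ I, C I * ∏ s, slotMat (κ s) h (I s) (J s) = C J)
    (hne : Fintype.card {s // κ s = true} ≠ Fintype.card {s // ¬ κ s = true}) : C = 0 := by
  obtain ⟨ζ, hζ, hζ'⟩ := exists_norm_eq_one_pow_ne hne
  ext J
  by_contra h0
  apply hζ'
  have h := hC (diagonal fun _ => ζ) (by
    rw [mem_unitaryGroup_iff', star_eq_conjTranspose, diagonal_conjTranspose, diagonal_mul_diagonal,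
        ← diagonal_one]
    congr 1; ext i; exact hζ) J
  have hs : ∀ b, slotMat b (diagonal fun _ : ι => ζ) =
      diagonal fun _ => if b then ζ else star ζ := by
    intro b
    cases b
    · simp [slotMat, bar, diagonal_map]
    · simp [slotMat]
  simp only [hs] at h
  rw [Finset.sum_eq_single J] at h
  · simp only [diagonal_apply_eq] at h
    rw [← Fintype.prod_subtype_mul_prod_subtype (fun s => κ s = true)] at h
    have h1 : ∏ s : {s // κ s = true}, (if κ s then ζ else star ζ) =
        ζ ^ Fintype.card {s // κ s = true} := by
      rw [Finset.prod_congr rfl fun s _ => if_pos s.2]; simp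
    have h2 : ∏ s : {s // ¬ κ s = true}, (if κ s then ζ else star ζ) =
        star ζ ^ Fintype.card {s // ¬ κ s = true} := by
      rw [Finset.prod_congr rfl fun s _ => if_neg s.2]; simp
    rw [h1, h2] at h
    have h3 : ζ ^ Fintype.card {s // κ s = true} * star ζ ^ Fintype.card {s // ¬ κ s = true} = 1 :=
      mul_left_cancel₀ h0 (by rw [h, mul_one])
    have h4 : star ζ ^ Fintype.card {s // ¬ κ s = true} *
        ζ ^ Fintype.card {s // ¬ κ s = true} = 1 := by
      rw [← mul_pow, hζ, one_pow]
    linear_combination ζ ^ Fintype.card {s // ¬ κ s = true} * h3 -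
      ζ ^ Fintype.card {s // κ s = true} * h4
  · intro I _ hI
    obtain ⟨s, hs⟩ := Function.ne_iff.mp hI
    refine mul_eq_zero_of_right _ (Finset.prod_eq_zero (Finset.mem_univ s) ?_)
    exact diagonal_apply_ne _ hs
  · simp

/-- **First fundamental theorem** for tensors: invariant tensors are combinations of complete
matchings. -/
theorem invariant_tensor_mem_span (κ : S → Bool) (C : (S → ι) → ℂ)
    (hC : ∀ h ∈ unitaryGroup ι ℂ, ∀ J, ∑ I, C I * ∏ s, slotMat (κ s) h (I s) (J s) = C J) :
    C ∈ Submodule.span ℂ (Set.range (matchTensor (ι := ι) κ)) := by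
  by_cases hne : Fintype.card {s // κ s = true} = Fintype.card {s // ¬ κ s = true}
  swap
  · rw [invariant_tensor_eq_zero κ C hC hne]; exact zero_mem _
  let σ₀ := Fintype.equivOfCardEq hne
  -- An arbitrary matching `σ₀` turns the tensor into a square matrix `D`: rows are indexed by the
  -- slots of kind `true`, columns by the others.
  let E : ({s // κ s = true} → ι) × ({s // κ s = true} → ι) ≃ (S → ι) :=
    (Equiv.prodCongr (Equiv.refl _) (Equiv.arrowCongr σ₀ (Equiv.refl ι))).trans
      (Equiv.piEquivPiSubtypeProd (fun s => κ s = true) fun _ => ι).symm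
  have hE1 : ∀ (A B : {s // κ s = true} → ι) (s : {s // κ s = true}), E (A, B) s = A s := by
    intro A B s
    simp [E, Equiv.piEquivPiSubtypeProd, s.2]
  have hE2 : ∀ (A B : {s // κ s = true} → ι) (s : {s // κ s = true}), E (A, B) (σ₀ s) = B s := by
    intro A B s
    have := (σ₀ s).2
    simp [E, Equiv.piEquivPiSubtypeProd, this]
  let D : Matrix ({s // κ s = true} → ι) ({s // κ s = true} → ι) ℂ := of fun A B => C (E (A, B))
  have hprod : ∀ (h : Matrix ι ι ℂ) A B A' B',
      ∏ s, slotMat (κ s) h (E (A, B) s) (E (A', B') s) =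
        tens {s // κ s = true} h A A' * tens {s // κ s = true} (bar h) B B' := by
    intro h A B A' B'
    rw [← Fintype.prod_subtype_mul_prod_subtype (fun s => κ s = true)]
    congr 1
    · rw [tens_apply]
      refine Finset.prod_congr rfl fun s _ => ?_
      rw [hE1, hE1, slotMat, if_pos s.2]
    · rw [tens_apply, ← σ₀.prod_comp]
      refine Finset.prod_congr rfl fun s _ => ?_
      rw [hE2, hE2, slotMat, if_neg (σ₀ s).2]
  have hD : ∀ h ∈ unitaryGroup ι ℂ, Commute D (tens {s // κ s = true} h) := by
    intro h hh
    -- Invariance is applied to `h̄` instead of `h`, so that the columns transform by `h` and the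
    -- rows by `h̄`; as `ᵗh̄ = h⁻¹`, this says that `D` commutes with the tensor power of `h`.
    have h1 : (tens {s // κ s = true} (bar h))ᵀ * D * tens {s // κ s = true} h = D := by
      ext A' B'
      have := hC (bar h) (bar_mem_unitaryGroup hh) (E (A', B'))
      rw [← E.sum_comp, Fintype.sum_prod_type] at this
      simp only [hprod] at this
      have hb : bar (bar h) = h := by ext; simp [bar]
      rw [hb] at this
      rw [show D A' B' = C (E (A', B')) from rfl, ← this, Matrix.mul_apply]
      simp only [Matrix.mul_apply, Finset.sum_mul, transpose_apply]
      rw [Finset.sum_comm]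
      refine Finset.sum_congr rfl fun A _ => Finset.sum_congr rfl fun B _ => ?_
      rw [show D A B = C (E (A, B)) from rfl]
      ring
    have h2 : tens {s // κ s = true} h * (tens {s // κ s = true} (bar h))ᵀ = 1 := by
      rw [← tens_transpose, ← tens_mul, ← tens_one]
      congr 1
      rw [mem_unitaryGroup_iff] at hh
      exact hh
    rw [Commute, SemiconjBy]
    nth_rewrite 2 [← h1]
    rw [← Matrix.mul_assoc, ← Matrix.mul_assoc, h2, Matrix.one_mul]
  obtain ⟨r, hr⟩ := exists_perm_of_tens_commute (tens_commute hD)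
  have : C = ∑ τ : Equiv.Perm {s // κ s = true}, r τ • matchTensor κ (τ.symm.trans σ₀) := by
    ext I
    obtain ⟨⟨A, B⟩, rfl⟩ := E.surjective I
    rw [show C (E (A, B)) = D A B from rfl, hr, Finset.sum_apply]
    refine Finset.sum_congr rfl fun τ _ => ?_
    rw [Pi.smul_apply, smul_eq_mul, matchTensor]
    congr 2
    simp only [Equiv.trans_apply, hE1, hE2, eq_iff_iff]
    rw [funext_iff, ← τ.symm.forall_congr_right]
    simp only [Function.comp_apply, Equiv.apply_symm_apply]
  rw [this]
  exact Submodule.sum_mem _ fun τ _ => Submodule.smul_mem _ _ (Submodule.subset_span ⟨_, rfl⟩)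

end InvariantTensor

/-! ### The algebra of all traces and words, with no bound on the exponent. -/

/-- The algebra generated by the `φ^{(2k)}`, `ψ^{(0,2k,0)}`, `ψ^{(0,2k,1)}`, `ψ^{(1,2k,0)}` for
all `k`. -/
def fullAlg (n m : ℕ) : Subalgebra ℂ (T n m → ℂ) :=
  Algebra.adjoin ℂ ({f | ∃ k, f = phi k} ∪ {f | ∃ k, ∃ a b : Fin m, f = psi00 k b a} ∪
    {f | ∃ k, ∃ a b : Fin m, f = psi01 k b a} ∪ {f | ∃ k, ∃ a b : Fin m, f = psi10 k b a})

theorem phi_mem_fullAlg {n m : ℕ} (k : ℕ) : phi k ∈ fullAlg n m :=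
  Algebra.subset_adjoin (Or.inl (Or.inl (Or.inl ⟨k, rfl⟩)))

theorem psi00_mem_fullAlg {n m : ℕ} (k : ℕ) (b a : Fin m) : psi00 k b a ∈ fullAlg n m :=
  Algebra.subset_adjoin (Or.inl (Or.inl (Or.inr ⟨k, a, b, rfl⟩)))

theorem psi01_mem_fullAlg {n m : ℕ} (k : ℕ) (b a : Fin m) : psi01 k b a ∈ fullAlg n m :=
  Algebra.subset_adjoin (Or.inl (Or.inr ⟨k, a, b, rfl⟩))

theorem psi10_mem_fullAlg {n m : ℕ} (k : ℕ) (b a : Fin m) : psi10 k b a ∈ fullAlg n m :=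
  Algebra.subset_adjoin (Or.inr ⟨k, a, b, rfl⟩)

theorem bar_transpose {p q : Type*} (A : Matrix p q ℂ) : (bar A)ᵀ = bar Aᵀ := rfl

theorem SymMat.transpose_eq {n : ℕ} (w : SymMat n) :
    (w : Matrix (Fin n) (Fin n) ℂ)ᵀ = w := w.2

theorem SymMat.bar_transpose_eq {n : ℕ} (w : SymMat n) :
    (bar (w : Matrix (Fin n) (Fin n) ℂ))ᵀ = bar (w : Matrix (Fin n) (Fin n) ℂ) := by
  rw [bar_transpose, SymMat.transpose_eq w]

/-! ### Contraction of words in `w` and `w̄`. -/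

section Contraction

variable {n m : ℕ} {Λ : Type*}

/-- The alternating word in `w` and `w̄` joining two ends: an end of kind `true` meets `w`, an end
of kind `false` meets `w̄`. -/
def wordMat (k : ℕ) (w : Matrix (Fin n) (Fin n) ℂ) : Bool → Bool → Matrix (Fin n) (Fin n) ℂ
  | true, true => (w * bar w) ^ k * w
  | true, false => (w * bar w) ^ k
  | false, true => (bar w * w) ^ k
  | false, false => bar w * (w * bar w) ^ k

theorem wordMat_transpose (k : ℕ) (w : SymMat n) (b c : Bool) :
    (wordMat k (w : Matrix (Fin n) (Fin n) ℂ) b c)ᵀ = wordMat k w c b := by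
  have h1 := SymMat.transpose_eq w
  have h2 := SymMat.bar_transpose_eq w
  generalize (w : Matrix (Fin n) (Fin n) ℂ) = v at h1 h2
  cases b <;> cases c <;>
    simp only [wordMat, transpose_mul, transpose_pow, h1, h2]
  · rw [← mul_pow_mul]
  · rw [mul_pow_mul]

/-- Summing over an index shared by a `false` end and a `true` end keeps the word alternating, so
words are closed under gluing. Only for outer ends `false`, `true` do the leading `w̄` and the
trailing `w` form an extra pair, whence the exponent `k + l + 1`. -/
theorem exists_wordMat_mul (n k l : ℕ) (b c : Bool) :
    ∃ j, ∀ w : Matrix (Fin n) (Fin n) ℂ,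
      wordMat k w b false * wordMat l w true c = wordMat j w b c := by
  cases b <;> cases c
  · exact ⟨k + l, fun w => by simp only [wordMat, pow_add, Matrix.mul_assoc]⟩
  · refine ⟨k + l + 1, fun w => ?_⟩
    simp only [wordMat]
    rw [Matrix.mul_assoc, ← Matrix.mul_assoc _ _ w, ← pow_add, mul_pow_mul, pow_succ',
      Matrix.mul_assoc]
  · exact ⟨k + l, fun w => by simp only [wordMat, pow_add]⟩
  · exact ⟨k + l, fun w => by simp only [wordMat, pow_add, Matrix.mul_assoc]⟩

variable (m Λ) in
/-- The end of a word: a row of `z̄` (kind `true`) or of `z` (kind `false`), or a free index. -/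
abbrev WordEnd : Type _ := Bool × (Fin m ⊕ Λ)

/-- The vector placed at the end of a word. -/
def endVec (x : T n m) (I : Λ → Fin n) : WordEnd m Λ → Fin n → ℂ
  | (true, .inl a) => bar x.2 a
  | (false, .inl a) => x.2 a
  | (_, .inr e) => Pi.single (I e) 1

/-- The value of a word with given ends. -/
def wordVal (k : ℕ) (p q : WordEnd m Λ) (x : T n m) (I : Λ → Fin n) : ℂ :=
  endVec x I p ⬝ᵥ (wordMat k (x.1 : Matrix (Fin n) (Fin n) ℂ) p.1 q.1 *ᵥ endVec x I q)

theorem wordVal_comm (k : ℕ) (p q : WordEnd m Λ) :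
    (wordVal k p q : T n m → (Λ → Fin n) → ℂ) = wordVal k q p := by
  ext x I
  rw [wordVal, wordVal, ← wordMat_transpose, dotProduct_comm, mulVec_transpose, dotProduct_mulVec]

theorem endVec_update [DecidableEq Λ] {p : WordEnd m Λ} {e : Λ} (hp : ∀ b, p ≠ (b, .inr e))
    (x : T n m) (I : Λ → Fin n) (i : Fin n) :
    endVec x (Function.update I e i) p = endVec x I p := by
  obtain ⟨b, a | e'⟩ := p
  · cases b <;> rfl
  · have : e' ≠ e := by rintro rfl; exact hp b rfl
    cases b <;> simp [endVec, Function.update_of_ne this]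

theorem wordVal_update [DecidableEq Λ] (k : ℕ) {p q : WordEnd m Λ} {e : Λ}
    (hp : ∀ b, p ≠ (b, .inr e)) (hq : ∀ b, q ≠ (b, .inr e)) (x : T n m) (I : Λ → Fin n)
    (i : Fin n) : wordVal k p q x (Function.update I e i) = wordVal k p q x I := by
  rw [wordVal, wordVal, endVec_update hp, endVec_update hq]

/-- A word without free indices is a `ψ`: the kinds of its two ends decide which one, and the two
mixed cases both give `psi00`. -/
theorem wordVal_inl_mem (k : ℕ) (b c : Bool) (a a' : Fin m) :
    ∃ f ∈ fullAlg n m, ∀ x (I : Λ → Fin n), wordVal k (b, .inl a) (c, .inl a') x I = f x := by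
  have key : ∀ (A B : Matrix (Fin m) (Fin n) ℂ) (X : Matrix (Fin n) (Fin n) ℂ) (a a' : Fin m),
      A a ⬝ᵥ (X *ᵥ B a') = (A * X * Bᵀ) a a' := by
    intro A B X a a'
    rw [dotProduct_mulVec, Matrix.mul_apply]
    rfl
  cases b <;> cases c
  · refine ⟨psi10 k a a', psi10_mem_fullAlg _ _ _, fun x I => ?_⟩
    simp only [wordVal, endVec, key, psi10, wordMat, Matrix.mul_assoc]
  · refine ⟨psi00 k a' a, psi00_mem_fullAlg _ _ _, fun x I => ?_⟩
    rw [wordVal_comm]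
    simp only [wordVal, endVec, key, psi00, wordMat]
  · refine ⟨psi00 k a a', psi00_mem_fullAlg _ _ _, fun x I => ?_⟩
    simp only [wordVal, endVec, key, psi00, wordMat]
  · refine ⟨psi01 k a a', psi01_mem_fullAlg _ _ _, fun x I => ?_⟩
    simp only [wordVal, endVec, key, psi01, wordMat, Matrix.mul_assoc]

theorem sum_wordVal_self [DecidableEq Λ] (k : ℕ) (e : Λ) (x : T n m) (I : Λ → Fin n) :
    ∑ i, wordVal k (true, .inr e) (false, .inr e) x (Function.update I e i) = phi k x := by
  simp [wordVal, endVec, wordMat, phi, Matrix.trace]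

theorem sum_wordVal_mul [DecidableEq Λ] (k l : ℕ) (e : Λ) {p q : WordEnd m Λ}
    (hp : ∀ b, p ≠ (b, .inr e)) (hq : ∀ b, q ≠ (b, .inr e)) :
    ∃ j, ∀ (x : T n m) (I : Λ → Fin n),
    ∑ i, wordVal k (false, .inr e) p x (Function.update I e i) *
      wordVal l (true, .inr e) q x (Function.update I e i) = wordVal j p q x I := by
  obtain ⟨j, hj⟩ := exists_wordMat_mul n k l p.1 q.1
  refine ⟨j, fun x I => ?_⟩
  have h : ∀ (r : ℕ) (b : Bool) (p : WordEnd m Λ), (∀ b, p ≠ (b, .inr e)) → ∀ i,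
      wordVal r (b, .inr e) p x (Function.update I e i) =
        (wordMat r (x.1 : Matrix (Fin n) (Fin n) ℂ) b p.1 *ᵥ endVec x I p) i := by
    intro r b p hp i
    rw [wordVal, endVec_update hp]
    cases b <;> simp [endVec]
  simp only [h _ _ _ hp, h _ _ _ hq]
  rw [← wordMat_transpose]
  simp only [mulVec_transpose]
  change _ ⬝ᵥ _ = _
  rw [← dotProduct_mulVec, mulVec_mulVec, hj, wordVal]

/-- `IsWordProduct s F`: the function `F` is an element of `fullAlg` times a product of words, whose
ends form the multiset `s`. -/
inductive IsWordProduct : Multiset (WordEnd m Λ) → (T n m → (Λ → Fin n) → ℂ) → Prop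
  | const {c : T n m → ℂ} (hc : c ∈ fullAlg n m) : IsWordProduct 0 fun x _ => c x
  | cons {s : Multiset (WordEnd m Λ)} {F : T n m → (Λ → Fin n) → ℂ} (k : ℕ) (p q : WordEnd m Λ)
      (h : IsWordProduct s F) : IsWordProduct (p ::ₘ q ::ₘ s) fun x I => wordVal k p q x I * F x I

namespace IsWordProduct

variable {s t : Multiset (WordEnd m Λ)} {F G : T n m → (Λ → Fin n) → ℂ}

theorem const_mul {c : T n m → ℂ} (hc : c ∈ fullAlg n m) (h : IsWordProduct s F) :
    IsWordProduct s fun x I => c x * F x I := by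
  induction h with
  | const hd => exact .const (mul_mem hc hd)
  | cons k p q _ ih =>
    convert! ih.cons k p q using 3
    ring

theorem mul (hF : IsWordProduct s F) (hG : IsWordProduct t G) :
    IsWordProduct (s + t) fun x I => F x I * G x I := by
  induction hF with
  | const hc => simpa using hG.const_mul hc
  | cons k p q _ ih =>
    convert! ih.cons k p q using 1
    · simp
    · ext; ring

/-- Isolates the word containing a prescribed end; words may be reversed by `wordVal_comm`, so that
end can be placed first. -/
theorem extract (h : IsWordProduct s F) {p : WordEnd m Λ} (hp : p ∈ s) :
    ∃ q t k G, s = p ::ₘ q ::ₘ t ∧ IsWordProduct t G ∧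
      F = fun x I => wordVal k p q x I * G x I := by
  induction h with
  | const => simp at hp
  | @cons s F k p' q' h ih =>
    rcases Multiset.mem_cons.mp hp with rfl | hp
    · exact ⟨q', s, k, F, rfl, h, rfl⟩
    rcases Multiset.mem_cons.mp hp with rfl | hp
    · exact ⟨p', s, k, F, Multiset.cons_swap _ _ _, h, by rw [wordVal_comm]⟩
    obtain ⟨q, t, l, G, rfl, hG, rfl⟩ := ih hp
    refine ⟨q, p' ::ₘ q' ::ₘ t, l, _, ?_, hG.cons k p' q', ?_⟩
    · simp only [← Multiset.singleton_add]; abel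
    · ext; ring

theorem update [DecidableEq Λ] (h : IsWordProduct s F) {e : Λ} (he : ∀ b, (b, .inr e) ∉ s)
    (x : T n m) (I : Λ → Fin n) (i : Fin n) : F x (Function.update I e i) = F x I := by
  induction h with
  | const => rfl
  | cons k p q h ih =>
    simp only [Multiset.mem_cons, not_or] at he
    beta_reduce
    rw [wordVal_update k (fun b => Ne.symm (he b).1) (fun b => Ne.symm (he b).2.1),
      ih fun b => (he b).2.2]

/-- Either both ends labelled `e` belong to the same word, which closes up to a trace `phi k`, or
they belong to two words, which are glued into one. -/
theorem contract [DecidableEq Λ] {e : Λ}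
    (h : IsWordProduct ((true, .inr e) ::ₘ (false, .inr e) ::ₘ s) F) (he : ∀ b, (b, .inr e) ∉ s) :
    IsWordProduct s fun x I => ∑ i, F x (Function.update I e i) := by
  obtain ⟨q, t, k, G, hst, hG, rfl⟩ := h.extract (Multiset.mem_cons_self _ _)
  rw [Multiset.cons_inj_right, Multiset.cons_eq_cons] at hst
  obtain ⟨rfl, rfl⟩ | ⟨-, t, rfl, rfl⟩ := hst
  · simp only [hG.update he, ← Finset.sum_mul, sum_wordVal_self]
    exact hG.const_mul (phi_mem_fullAlg k)
  · obtain ⟨q', t', l, G', hst, hG', rfl⟩ := hG.extract (Multiset.mem_cons_self _ _)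
    rw [Multiset.cons_inj_right] at hst
    subst hst
    simp only [Multiset.mem_cons, not_or] at he
    have hq : ∀ b, q ≠ (b, .inr e) := fun b => Ne.symm (he b).1
    have hq' : ∀ b, q' ≠ (b, .inr e) := fun b => Ne.symm (he b).2.1
    obtain ⟨j, hj⟩ := sum_wordVal_mul (n := n) l k e hq' hq
    convert! hG'.cons j q' q using 1
    · exact Multiset.cons_swap _ _ _
    · ext x I
      rw [← hj, Finset.sum_mul]
      refine Finset.sum_congr rfl fun i _ => ?_
      beta_reduce
      rw [hG'.update fun b => (he b).2.2]
      ring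

theorem exists_of_inl (h : IsWordProduct s F) (hs : ∀ p ∈ s, ∃ b a, p = (b, .inl a)) :
    ∃ c ∈ fullAlg n m, ∀ x I, F x I = c x := by
  induction h with
  | const hc => exact ⟨_, hc, fun _ _ => rfl⟩
  | cons k p q h ih =>
    obtain ⟨c, hc, hF⟩ := ih fun p hp => hs p (by simp [hp])
    obtain ⟨b, a, rfl⟩ := hs p (by simp)
    obtain ⟨b', a', rfl⟩ := hs q (by simp)
    obtain ⟨f, hf, hf'⟩ := wordVal_inl_mem (n := n) (Λ := Λ) k b b' a a'
    exact ⟨f * c, mul_mem hf hc, fun x I => by simp only [hf', hF]; rfl⟩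

/-- Partial contraction: the indices in `t` are summed over, those outside stay fixed at `I`. This
form allows contracting one index at a time. -/
theorem contract_finset [Fintype Λ] [DecidableEq Λ] (t : Finset Λ) :
    ∀ {s : Multiset (WordEnd m Λ)} {F : T n m → (Λ → Fin n) → ℂ},
    (∀ e ∈ t, ∀ b, (b, .inr e) ∉ s) →
    IsWordProduct (∑ e ∈ t, ({(true, .inr e), (false, .inr e)} : Multiset (WordEnd m Λ)) + s) F →
    IsWordProduct s fun x I => ∑ J : Λ → Fin n, if ∀ e ∉ t, J e = I e then F x J else 0 := by
  induction t using Finset.induction_on with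
  | empty =>
    intro s F _ h
    simp only [Finset.notMem_empty, not_false_eq_true, forall_const, ← funext_iff]
    simpa using h
  | insert e t het ih =>
    intro s F hs h
    have h1 := ih (s := (true, .inr e) ::ₘ (false, .inr e) ::ₘ s) (F := F) (by
      intro e' he' b
      have hne : e' ≠ e := by rintro rfl; exact het he'
      simpa [hne] using hs e' (Finset.mem_insert_of_mem he') b) (by
      convert h using 1
      rw [Finset.sum_insert het]
      simp only [← Multiset.singleton_add, Multiset.insert_eq_cons]; abel)
    convert h1.contract (hs e (Finset.mem_insert_self e t)) using 1
    ext x I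
    rw [Finset.sum_comm]
    refine Finset.sum_congr rfl fun J _ => ?_
    have hiff : ∀ i, (∀ e' ∉ t, J e' = Function.update I e i e') ↔
        (i = J e ∧ ∀ e' ∉ insert e t, J e' = I e') := by
      intro i
      constructor
      · intro h
        refine ⟨by simpa using (h e het).symm, fun e' he' => ?_⟩
        simp only [Finset.mem_insert, not_or] at he'
        simpa [he'.1] using h e' he'.2
      · rintro ⟨rfl, h⟩ e' he'
        by_cases hee : e' = e
        · subst hee; simp
        · simpa [hee] using h e' (by simp [hee, he'])
    simp only [hiff, ite_and, Finset.sum_ite_eq', Finset.mem_univ, if_true]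

/-- The complete contraction of a product of words lies in `fullAlg`. -/
theorem sum_mem [Fintype Λ] [DecidableEq Λ] (hs : ∀ p ∈ s, ∃ b a, p = (b, .inl a))
    (h : IsWordProduct
      (∑ e : Λ, ({(true, .inr e), (false, .inr e)} : Multiset (WordEnd m Λ)) + s) F) :
    (fun x => ∑ J : Λ → Fin n, F x J) ∈ fullAlg n m := by
  obtain ⟨c, hc, h⟩ := (contract_finset Finset.univ (by
    intro e _ b hb
    obtain ⟨_, _, h⟩ := hs _ hb
    simp at h) h).exists_of_inl hs
  -- With no index assignment at all the sum is empty. Otherwise any `I` serves, since the full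
  -- contraction does not depend on it.
  rcases isEmpty_or_nonempty (Λ → Fin n) with hΛ | ⟨⟨I⟩⟩
  · simp only [Finset.univ_eq_empty, Finset.sum_empty]
    exact (fullAlg n m).zero_mem
  · convert hc using 2 with x
    rw [← h x I]
    simp

end IsWordProduct

end Contraction

/-! ### Coordinate functions and their transformation under `U(n)`. -/

/-- The types of coordinate functions on `T n m`: entries of `w`, of `w̄`, of a row of `z` and of
a row of `z̄`. -/
inductive CoordType (m : ℕ)
  | w
  | wBar
  | z (a : Fin m)
  | zBar (a : Fin m)

namespace CoordType

variable {n m : ℕ} {Λ : Type*}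

/-- The number of indices of a coordinate function. -/
def arity : CoordType m → ℕ
  | w => 2
  | wBar => 2
  | z _ => 1
  | zBar _ => 1

/-- The kind of the indices: `true` if they transform by `h` and `false` if they transform by
`h̄`. -/
def kind : CoordType m → Bool
  | w => true
  | wBar => false
  | z _ => true
  | zBar _ => false

/-- The coordinate function of given type and indices. -/
def coord : (t : CoordType m) → (Fin t.arity → Fin n) → T n m → ℂ
  | w, I, x => (x.1 : Matrix (Fin n) (Fin n) ℂ) (I (0 : Fin 2)) (I (1 : Fin 2))
  | wBar, I, x => bar (x.1 : Matrix (Fin n) (Fin n) ℂ) (I (0 : Fin 2)) (I (1 : Fin 2))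
  | z a, I, x => x.2 a (I (0 : Fin 1))
  | zBar a, I, x => bar x.2 a (I (0 : Fin 1))

theorem coord_act (t : CoordType m) (h : unitaryGroup (Fin n) ℂ) (I : Fin t.arity → Fin n)
    (x : T n m) : t.coord I (act h x) =
      ∑ J, (∏ j, slotMat t.kind (h : Matrix (Fin n) (Fin n) ℂ) (I j) (J j)) * t.coord J x := by
  have two : ∀ (A X : Matrix (Fin n) (Fin n) ℂ) (I : Fin 2 → Fin n),
      (A * X * Aᵀ) (I 0) (I 1) = ∑ J : Fin 2 → Fin n, (∏ j, A (I j) (J j)) * X (J 0) (J 1) := by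
    intro A X I
    rw [← (finTwoArrowEquiv (Fin n)).symm.sum_comp, Fintype.sum_prod_type, Finset.sum_comm]
    simp only [Matrix.mul_apply, Finset.sum_mul, transpose_apply, Fin.prod_univ_two,
      finTwoArrowEquiv_symm_apply, cons_val_zero, cons_val_one]
    exact Finset.sum_congr rfl fun i _ => Finset.sum_congr rfl fun j _ => by ring
  have one : ∀ (A : Matrix (Fin n) (Fin n) ℂ) (X : Fin n → ℂ) (I : Fin 1 → Fin n),
      ∑ i, X i * A (I 0) i = ∑ J : Fin 1 → Fin n, (∏ j, A (I j) (J j)) * X (J 0) := by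
    intro A X I
    rw [← (Equiv.funUnique (Fin 1) (Fin n)).symm.sum_comp]
    simp [mul_comm]
  cases t with
  | w => exact two h x.1 I
  | wBar =>
    refine Eq.trans ?_ (two (bar h) (bar x.1) I)
    change bar _ _ _ = _
    simp only [act, bar, Matrix.map_mul]
    rfl
  | z a => exact one h (x.2 a) I
  | zBar a =>
    refine Eq.trans ?_ (one (bar h) (bar x.2 a) I)
    change bar (x.2 * (h : Matrix (Fin n) (Fin n) ℂ)ᵀ) a _ = _
    rw [bar, Matrix.map_mul]
    rfl

/-- The ends of a coordinate function without indices. -/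
def fixedEnds (Λ : Type*) : CoordType m → Multiset (WordEnd m Λ)
  | w => 0
  | wBar => 0
  | z a => {(false, .inl a)}
  | zBar a => {(true, .inl a)}

theorem exists_of_mem_fixedEnds {t : CoordType m} {p : WordEnd m Λ} (hp : p ∈ t.fixedEnds Λ) :
    ∃ b a, p = (b, .inl a) := by
  cases t <;> simp [fixedEnds] at hp <;> exact ⟨_, _, hp⟩

/-- Each coordinate is a word of exponent `0`. An entry of `z` or `z̄` joins a free index to a fixed
end of the opposite kind, so that the matrix in between is the identity. -/
theorem isWordProduct_coord (t : CoordType m) (r : Fin t.arity → Λ) :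
    IsWordProduct (n := n) (∑ j, {(t.kind, .inr (r j))} + t.fixedEnds Λ)
      fun x I => t.coord (I ∘ r) x := by
  have key : ∀ (p q : WordEnd m Λ) (F : T n m → (Λ → Fin n) → ℂ),
      (wordVal 0 p q : T n m → (Λ → Fin n) → ℂ) = F → IsWordProduct {p, q} F := by
    rintro p q _ rfl
    simpa using (IsWordProduct.const (n := n) (Λ := Λ) (fullAlg n m).one_mem).cons 0 p q
  cases t with
  | w =>
    have hs : (∑ j : Fin 2, ({(true, .inr (r j))} : Multiset (WordEnd m Λ)) + 0) =
        {(true, .inr (r (0 : Fin 2))), (true, .inr (r (1 : Fin 2)))} := by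
      rw [Fin.sum_univ_two, add_zero]
      rfl
    refine hs ▸ key _ _ _ ?_
    ext x I
    simp [wordVal, wordMat, endVec, coord]
    rfl
  | wBar =>
    have hs : (∑ j : Fin 2, ({(false, .inr (r j))} : Multiset (WordEnd m Λ)) + 0) =
        {(false, .inr (r (0 : Fin 2))), (false, .inr (r (1 : Fin 2)))} := by
      rw [Fin.sum_univ_two, add_zero]
      rfl
    refine hs ▸ key _ _ _ ?_
    ext x I
    simp [wordVal, wordMat, endVec, coord]
    rfl
  | z a =>
    have hs : (∑ j : Fin 1, ({(true, .inr (r j))} : Multiset (WordEnd m Λ)) + {(false, .inl a)}) =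
        {(true, .inr (r (0 : Fin 1))), (false, .inl a)} := by
      rw [Fin.sum_univ_one]
      rfl
    refine hs ▸ key _ _ _ ?_
    ext x I
    simp [wordVal, wordMat, endVec, coord]
    rfl
  | zBar a =>
    have hs : (∑ j : Fin 1, ({(false, .inr (r j))} : Multiset (WordEnd m Λ)) + {(true, .inl a)}) =
        {(false, .inr (r (0 : Fin 1))), (true, .inl a)} := by
      rw [Fin.sum_univ_one]
      rfl
    refine hs ▸ key _ _ _ ?_
    ext x I
    simp [wordVal, wordMat, endVec, coord]
    rfl

end CoordType

/-! ### Monomials in the coordinates and their contractions. -/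

section Monomial

variable {n m N : ℕ}

/-- The index slots of a word of coordinate types. -/
abbrev Slot (τ : Fin N → CoordType m) : Type := Σ k, Fin (τ k).arity

/-- The monomial in the coordinates attached to a word of types and to indices. -/
def monom (τ : Fin N → CoordType m) (I : Slot τ → Fin n) (x : T n m) : ℂ :=
  ∏ k, (τ k).coord (fun j => I ⟨k, j⟩) x

/-- The kind of a slot. -/
def slotKind (τ : Fin N → CoordType m) (s : Slot τ) : Bool := (τ s.1).kind

theorem monom_act (τ : Fin N → CoordType m) (I : Slot τ → Fin n) (h : unitaryGroup (Fin n) ℂ)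
    (x : T n m) : monom τ I (act h x) =
      ∑ J, (∏ s, slotMat (slotKind τ s) (h : Matrix (Fin n) (Fin n) ℂ) (I s) (J s)) *
        monom τ J x := by
  simp only [monom, CoordType.coord_act, Finset.prod_univ_sum]
  refine Finset.sum_bij' (fun J _ s => J s.1 s.2) (fun J _ k j => J ⟨k, j⟩) ?_ ?_ ?_ ?_ ?_
  · simp
  · simp
  · intro J _; rfl
  · intro J _; rfl
  · intro J _
    rw [Finset.prod_mul_distrib, Fintype.prod_sigma]
    rfl

theorem contraction_mem (τ : Fin N → CoordType m)
    (σ : {s // slotKind τ s = true} ≃ {s // ¬ slotKind τ s = true}) :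
    (fun x : T n m => ∑ I, matchTensor (slotKind τ) σ I * monom τ I x) ∈ fullAlg n m := by
  let Λ := {s // slotKind τ s = true}
  -- Each pair of the matching is labelled by its slot of kind `true`. Index assignments compatible
  -- with the matching are exactly those of the form `J ∘ r`.
  let r : Slot τ → Λ := fun s => if hs : slotKind τ s = true then ⟨s, hs⟩ else σ.symm ⟨s, hs⟩
  have hr1 : ∀ s : Λ, r s = s := fun s => by simp [r, s.2]
  have hr2 : ∀ s : {s // ¬ slotKind τ s = true}, r s = σ.symm s := fun s => by simp [r, s.2]
  have hsum : ∀ x : T n m, ∑ I, matchTensor (slotKind τ) σ I * monom τ I x =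
      ∑ J : Λ → Fin n, monom τ (J ∘ r) x := by
    intro x
    simp only [matchTensor, ite_mul, one_mul, zero_mul]
    rw [← Finset.sum_filter]
    symm
    refine Finset.sum_bij' (fun J _ => J ∘ r) (fun I _ => fun s : Λ => I s) ?_ ?_ ?_ ?_
      fun _ _ => rfl
    · intro J _
      simp only [Finset.mem_filter, Finset.mem_univ, true_and, Function.comp_apply, hr1, hr2,
        Equiv.symm_apply_apply, implies_true]
    · simp
    · intro J _
      ext s
      simp [hr1]
    · intro I hI
      simp only [Finset.mem_filter, Finset.mem_univ, true_and] at hI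
      ext s
      by_cases hs : slotKind τ s = true
      · simp [r, hs]
      · have := hI (σ.symm ⟨s, hs⟩)
        rw [Equiv.apply_symm_apply] at this
        simp [r, hs, this]
  simp only [hsum]
  have hprod : ∀ t : Finset (Fin N), IsWordProduct (n := n)
      (∑ k ∈ t, (∑ j, {((τ k).kind, .inr (r ⟨k, j⟩))} + (τ k).fixedEnds Λ))
      fun x J => ∏ k ∈ t, (τ k).coord (fun j => J (r ⟨k, j⟩)) x := by
    intro t
    induction t using Finset.induction_on with
    | empty => simpa using! IsWordProduct.const (n := n) (m := m) (Λ := Λ) (fullAlg n m).one_mem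
    | insert k t hk ih =>
      simp only [Finset.sum_insert hk, Finset.prod_insert hk]
      exact ((τ k).isWordProduct_coord fun j => r ⟨k, j⟩).mul ih
  refine IsWordProduct.sum_mem (s := ∑ k, (τ k).fixedEnds Λ) ?_ ?_
  · intro p hp
    obtain ⟨k, _, hk⟩ := Multiset.mem_sum.mp hp
    exact CoordType.exists_of_mem_fixedEnds hk
  · convert! hprod Finset.univ using 1
    rw [Finset.sum_add_distrib]
    congr 1
    rw [← Fintype.sum_sigma' (f := fun (k : Fin N) (j : Fin (τ k).arity) =>
      ({((τ k).kind, .inr (r ⟨k, j⟩))} : Multiset (WordEnd m Λ)))]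
    change _ = ∑ s : Slot τ, ({(slotKind τ s, .inr (r s))} : Multiset (WordEnd m Λ))
    rw [← Fintype.sum_subtype_add_sum_subtype (fun s => slotKind τ s = true), ← σ.sum_comp,
      ← Finset.sum_add_distrib]
    refine Finset.sum_congr rfl fun e _ => ?_
    rw [hr1, hr2, e.2, Bool.eq_false_of_not_eq_true (σ e).2, Equiv.symm_apply_apply]
    rfl

end Monomial

/-! ### Lifting invariants to coefficients. -/

section Lift

/-- Invariant vectors lift along linear maps that are compatible with a unitary action. -/
theorem exists_invariant_preimage {G E F : Type*} [Group G] [NormedAddCommGroup E]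
    [InnerProductSpace ℂ E] [FiniteDimensional ℂ E] [AddCommGroup F] [Module ℂ F]
    (Φ : E →ₗ[ℂ] F) (R : G → E →ₗ[ℂ] E) (ρ : G → F →ₗ[ℂ] F)
    (hΦ : ∀ g c, Φ (R g c) = ρ g (Φ c))
    (hR : ∀ g a b, inner ℂ (R g⁻¹ a) b = inner ℂ a (R g b))
    (c : E) (hc : ∀ g, ρ g (Φ c) = Φ c) :
    ∃ c', Φ c' = Φ c ∧ ∀ g, R g c' = c' := by
  -- The component `b` orthogonal to the kernel is the invariant lift. The kernel is stable under
  -- every `R g`, hence so is its orthogonal complement by `hR`; thus `R g b - b` lies in both and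
  -- is zero. No averaging over the group is needed.
  obtain ⟨a, ha, b, hb, rfl⟩ := (LinearMap.ker Φ).exists_add_mem_mem_orthogonal c
  have hab : Φ (a + b) = Φ b := by rw [map_add, LinearMap.mem_ker.mp ha, zero_add]
  rw [hab] at hc ⊢
  refine ⟨b, rfl, fun g => ?_⟩
  have h1 : R g b - b ∈ LinearMap.ker Φ := by
    rw [LinearMap.mem_ker, map_sub, hΦ, hc, sub_self]
  have h2 : R g b - b ∈ (LinearMap.ker Φ)ᗮ := by
    refine sub_mem ?_ hb
    rw [Submodule.mem_orthogonal] at hb ⊢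
    intro u hu
    rw [← hR]
    refine hb _ ?_
    rw [LinearMap.mem_ker, hΦ, LinearMap.mem_ker.mp hu, map_zero]
  have h3 := (Submodule.mem_orthogonal _ _).mp h2 _ h1
  rw [inner_self_eq_zero] at h3
  exact sub_eq_zero.mp h3

end Lift

/-! ### Polynomial functions as combinations of monomials. -/

section Coordinates

variable {n m : ℕ}

/-- A real-linear form is a combination of the entries and their conjugates, with the Wirtinger
derivatives as coefficients. -/
theorem linearMap_eq_sum {p q : Type*} [Fintype p] [Fintype q] [DecidableEq p] [DecidableEq q]
    (l : Matrix p q ℂ →ₗ[ℝ] ℂ) (A : Matrix p q ℂ) :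
    l A = ∑ i, ∑ j, ((l (single i j 1) - Complex.I * l (single i j Complex.I)) / 2 * A i j +
      (l (single i j 1) + Complex.I * l (single i j Complex.I)) / 2 * bar A i j) := by
  conv_lhs => rw [matrix_eq_sum_single A]
  rw [map_sum]
  refine Finset.sum_congr rfl fun i _ => ?_
  rw [map_sum]
  refine Finset.sum_congr rfl fun j _ => ?_
  have h : single i j (A i j) = (A i j).re • single i j (1 : ℂ) +
      (A i j).im • single i j Complex.I := by
    rw [smul_single, smul_single, ← single_add]
    congr 1
    apply Complex.ext <;> simp
  rw [h, map_add, map_smul, map_smul]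
  simp only [bar, map_apply]
  apply Complex.ext <;> simp <;> ring

/-- The projection of matrices onto symmetric matrices. -/
def symProj (n : ℕ) : Matrix (Fin n) (Fin n) ℂ →ₗ[ℂ] SymMat n :=
  LinearMap.codRestrict (SymMat n)
    ((1 / 2 : ℂ) • (LinearMap.id + (transposeLinearEquiv (Fin n) (Fin n) ℂ ℂ).toLinearMap))
    fun A => by
      change (_ : Matrix (Fin n) (Fin n) ℂ)ᵀ = _
      simp [add_comm]

theorem symProj_coe (w : SymMat n) : symProj n w = w := by
  apply Subtype.ext
  have := SymMat.transpose_eq w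
  change (1 / 2 : ℂ) • ((w : Matrix (Fin n) (Fin n) ℂ) + (w : Matrix (Fin n) (Fin n) ℂ)ᵀ) = _
  rw [this, ← two_smul ℂ, smul_smul]
  norm_num

/-- The set of all coordinate functions. -/
def coords (n m : ℕ) : Set (T n m → ℂ) :=
  {f | ∃ (t : CoordType m) (I : Fin t.arity → Fin n), f = t.coord I}

theorem Pol_le_adjoin_coords : Pol ℂ (T n m) ≤ Algebra.adjoin ℂ (coords n m) := by
  refine Algebra.adjoin_le ?_
  rintro _ ⟨l, rfl⟩
  -- The form is extended from symmetric to all matrices by the symmetrizing projection, so that all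
  -- entries can be treated as independent.
  let l₁ : Matrix (Fin n) (Fin n) ℂ →ₗ[ℝ] ℂ :=
    l ∘ₗ LinearMap.inl ℝ (SymMat n) _ ∘ₗ (symProj n).restrictScalars ℝ
  let l₂ : Matrix (Fin m) (Fin n) ℂ →ₗ[ℝ] ℂ := l ∘ₗ LinearMap.inr ℝ (SymMat n) _
  have hl : (l : T n m → ℂ) = (fun x => l₁ x.1) + fun x => l₂ x.2 := by
    ext x
    simp only [l₁, l₂, Pi.add_apply, LinearMap.comp_apply, LinearMap.restrictScalars_apply,
      symProj_coe, ← map_add, LinearMap.inl_apply, LinearMap.inr_apply, Prod.mk_add_mk, add_zero, zero_add]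
  rw [hl]
  have hw : ∀ i j, (fun x : T n m => (x.1 : Matrix (Fin n) (Fin n) ℂ) i j) ∈
      Algebra.adjoin ℂ (coords n m) := fun i j =>
    Algebra.subset_adjoin ⟨.w, ![i, j], rfl⟩
  have hwb : ∀ i j, (fun x : T n m => bar (x.1 : Matrix (Fin n) (Fin n) ℂ) i j) ∈
      Algebra.adjoin ℂ (coords n m) := fun i j =>
    Algebra.subset_adjoin ⟨.wBar, ![i, j], rfl⟩
  have hz : ∀ i j, (fun x : T n m => x.2 i j) ∈ Algebra.adjoin ℂ (coords n m) := fun i j =>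
    Algebra.subset_adjoin ⟨.z i, ![j], rfl⟩
  have hzb : ∀ i j, (fun x : T n m => bar x.2 i j) ∈ Algebra.adjoin ℂ (coords n m) := fun i j =>
    Algebra.subset_adjoin ⟨.zBar i, ![j], rfl⟩
  have key : ∀ {p q : Type} [Fintype p] [Fintype q] (a b : p → q → ℂ) (f g : p → q → T n m → ℂ),
      (∀ i j, f i j ∈ Algebra.adjoin ℂ (coords n m)) →
      (∀ i j, g i j ∈ Algebra.adjoin ℂ (coords n m)) →
      (fun x => ∑ i, ∑ j, (a i j * f i j x + b i j * g i j x)) ∈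
        Algebra.adjoin ℂ (coords n m) := by
    intro p q _ _ a b f g hf hg
    have : (fun x => ∑ i, ∑ j, (a i j * f i j x + b i j * g i j x)) =
        ∑ i, ∑ j, (a i j • f i j + b i j • g i j) := by
      ext x; simp
    rw [this]
    exact sum_mem fun i _ => sum_mem fun j _ => add_mem (Subalgebra.smul_mem _ (hf i j) _)
      (Subalgebra.smul_mem _ (hg i j) _)
  have h₁ : (fun x : T n m => l₁ x.1) ∈ Algebra.adjoin ℂ (coords n m) := by
    rw [funext fun x : T n m => linearMap_eq_sum l₁ x.1]
    exact key _ _ _ _ hw hwb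
  have h₂ : (fun x : T n m => l₂ x.2) ∈ Algebra.adjoin ℂ (coords n m) := by
    rw [funext fun x : T n m => linearMap_eq_sum l₂ x.2]
    exact key _ _ _ _ hz hzb
  exact add_mem h₁ h₂

/-- The index set of all monomials with given word of types. -/
abbrev WordShape (m : ℕ) : Type := Σ N : ℕ, Fin N → CoordType m

theorem Pol_le_span_monom {f : T n m → ℂ} (hf : f ∈ Pol ℂ (T n m)) :
    f ∈ Submodule.span ℂ (Set.range fun ω : Σ τ : WordShape m, (Slot τ.2 → Fin n) =>
      monom ω.1.2 ω.2) := by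
  have h := Pol_le_adjoin_coords hf
  rw [← Subalgebra.mem_toSubmodule, Algebra.adjoin_eq_span] at h
  refine Submodule.span_mono ?_ h
  intro g hg
  induction hg using Submonoid.closure_induction_left with
  | one => exact ⟨⟨⟨0, Fin.elim0⟩, fun s => s.1.elim0⟩, by ext x; simp [monom]⟩
  | mul_left a ha b hb ih =>
    obtain ⟨t, I, rfl⟩ := ha
    obtain ⟨⟨⟨N, τ⟩, J⟩, rfl⟩ := ih
    refine ⟨⟨⟨N + 1, Fin.cons t τ⟩, fun s => Fin.cases
      (motive := fun k => Fin (Fin.cons (α := fun _ => CoordType m) t τ k).arity → Fin n)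
      I (fun k j => J ⟨k, j⟩) s.1 s.2⟩, ?_⟩
    ext x
    simp only [monom, Fin.prod_univ_succ]
    rfl

end Coordinates

/-! ### Invariant polynomials are generated by traces and words. -/

section Main

variable {n m : ℕ}

theorem slotMat_inv (b : Bool) (h : unitaryGroup (Fin n) ℂ) (i j : Fin n) :
    slotMat b ((h⁻¹ : unitaryGroup (Fin n) ℂ) : Matrix (Fin n) (Fin n) ℂ) i j =
      starRingEnd ℂ (slotMat b (h : Matrix (Fin n) (Fin n) ℂ) j i) := by
  cases b <;> rfl

/-- The action of the unitary group on coefficients of monomials. -/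
def coeffAct (t : Finset (WordShape m)) (h : unitaryGroup (Fin n) ℂ) :
    EuclideanSpace ℂ (Σ τ : t, (Slot τ.1.2 → Fin n)) →ₗ[ℂ]
      EuclideanSpace ℂ (Σ τ : t, (Slot τ.1.2 → Fin n)) where
  toFun c := WithLp.toLp 2 fun ω => ∑ I, c ⟨ω.1, I⟩ *
    ∏ s, slotMat (slotKind ω.1.1.2 s) (h : Matrix (Fin n) (Fin n) ℂ) (I s) (ω.2 s)
  map_add' c d := by ext ω; simp [add_mul, Finset.sum_add_distrib]
  map_smul' a c := by ext ω; simp [Finset.mul_sum, mul_assoc]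

/-- The polynomial function with given coefficients. -/
def ofCoeff (t : Finset (WordShape m)) :
    EuclideanSpace ℂ (Σ τ : t, (Slot τ.1.2 → Fin n)) →ₗ[ℂ] (T n m → ℂ) where
  toFun c := ∑ ω, c ω • monom ω.1.1.2 ω.2
  map_add' c d := by simp [add_smul, Finset.sum_add_distrib]
  map_smul' a c := by simp [Finset.smul_sum, smul_smul]

theorem ofCoeff_coeffAct (t : Finset (WordShape m)) (h : unitaryGroup (Fin n) ℂ)
    (c : EuclideanSpace ℂ (Σ τ : t, (Slot τ.1.2 → Fin n))) :
    ofCoeff t (coeffAct t h c) = LinearMap.funLeft ℂ ℂ (act h) (ofCoeff t c) := by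
  ext x
  simp only [ofCoeff, coeffAct, LinearMap.coe_mk, AddHom.coe_mk, LinearMap.funLeft_apply,
    Finset.sum_apply, Pi.smul_apply, smul_eq_mul, monom_act, Fintype.sum_sigma, Finset.mul_sum,
    Finset.sum_mul]
  refine Finset.sum_congr rfl fun τ _ => ?_
  rw [Finset.sum_comm]
  refine Finset.sum_congr rfl fun I _ => Finset.sum_congr rfl fun J _ => by ring

/-- The inverse of a unitary matrix is its conjugate transpose, and the same holds for its tensor
powers; hence the adjoint of the action of `h` is the action of `h⁻¹`. -/
theorem inner_coeffAct (t : Finset (WordShape m)) (h : unitaryGroup (Fin n) ℂ)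
    (a b : EuclideanSpace ℂ (Σ τ : t, (Slot τ.1.2 → Fin n))) :
    inner ℂ (coeffAct t h⁻¹ a) b = inner ℂ a (coeffAct t h b) := by
  simp only [PiLp.inner_apply, coeffAct, LinearMap.coe_mk, AddHom.coe_mk, RCLike.inner_apply,
    map_sum, map_mul, map_prod, slotMat_inv, Complex.conj_conj, Fintype.sum_sigma, Finset.mul_sum,
    Finset.sum_mul]
  refine Finset.sum_congr rfl fun τ _ => ?_
  refine (Finset.sum_comm (s := Finset.univ) (t := Finset.univ)).trans ?_
  refine Finset.sum_congr rfl fun I _ => Finset.sum_congr rfl fun J _ => by ring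

theorem contraction_mem_of_mem_span {N : ℕ} (τ : Fin N → CoordType m) {C : (Slot τ → Fin n) → ℂ}
    (hC : C ∈ Submodule.span ℂ (Set.range (matchTensor (slotKind τ)))) :
    (fun x : T n m => ∑ I, C I * monom τ I x) ∈ fullAlg n m := by
  induction hC using Submodule.span_induction with
  | mem D hD =>
    obtain ⟨σ, rfl⟩ := hD
    exact contraction_mem τ σ
  | zero =>
    simp only [Pi.zero_apply, zero_mul, Finset.sum_const_zero]
    exact zero_mem _
  | add D D' _ _ h h' =>
    simp only [Pi.add_apply, add_mul, Finset.sum_add_distrib]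
    exact add_mem h h'
  | smul r D _ h =>
    simp only [Pi.smul_apply, smul_eq_mul, mul_assoc, ← Finset.mul_sum]
    exact Subalgebra.smul_mem _ h r

theorem PolInv_le_fullAlg : PolInv ℂ n m ≤ fullAlg n m := by
  classical
  rintro f ⟨hf, hinv⟩
  obtain ⟨t, c, rfl⟩ : ∃ t c, ofCoeff (n := n) (m := m) t c = f := by
    obtain ⟨c, rfl⟩ := Finsupp.mem_span_range_iff_exists_finsupp.mp (Pol_le_span_monom hf)
    -- All index fillings of each occurring word are included, some with coefficient zero, so that
    -- the coefficient space is stable under the action.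
    refine ⟨c.support.image Sigma.fst, WithLp.toLp 2 fun ω => c ⟨ω.1.1, ω.2⟩, ?_⟩
    simp only [ofCoeff, LinearMap.coe_mk, AddHom.coe_mk, Finsupp.sum]
    symm
    rw [Finset.sum_subset (s₂ := (c.support.image Sigma.fst).sigma fun _ => Finset.univ)]
    · rw [Finset.sum_sigma, ← Finset.sum_coe_sort, Fintype.sum_sigma]
    · intro ω hω
      simpa using ⟨ω.2, by simpa using hω⟩
    · intro ω _ hω
      rw [Finsupp.notMem_support_iff.mp hω, zero_smul]
  obtain ⟨c, hc, hcinv⟩ := exists_invariant_preimage (ofCoeff t) (coeffAct t)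
    (fun h => LinearMap.funLeft ℂ ℂ (act h)) (ofCoeff_coeffAct t) (inner_coeffAct t) c
    fun h => funext (hinv h)
  rw [← hc]
  have hsum : ofCoeff t c = ∑ τ : t, fun x => ∑ I, c ⟨τ, I⟩ * monom τ.1.2 I x := by
    ext x
    simp [ofCoeff, Fintype.sum_sigma]
  rw [hsum]
  refine sum_mem fun τ _ => ?_
  have hspan := invariant_tensor_mem_span (slotKind τ.1.2) (fun I : Slot τ.1.2 → Fin n => c ⟨τ, I⟩)
    fun h hh J => congrArg (fun d => d.ofLp ⟨τ, J⟩) (hcinv ⟨h, hh⟩)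
  exact contraction_mem_of_mem_span τ.1.2 hspan

end Main

/-! ### Newton's identities and the Cayley–Hamilton recurrence. -/

section Newton

open Polynomial

variable {ι R : Type*} [Fintype ι] [DecidableEq ι] [CommRing R]

/-- **Jacobi's formula** for matrices of polynomials. -/
theorem derivative_det_eq_trace (M : Matrix ι ι R[X]) :
    derivative M.det = (M.adjugate * M.map derivative).trace := by
  have h : ∀ i, (M.adjugate * M.map derivative) i i =
      (M.updateCol i fun j => derivative (M j i)).det := by
    intro i
    rw [← cramer_apply, cramer_eq_adjugate_mulVec]
    rfl
  simp only [Matrix.trace, diag_apply, h]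
  simp only [det_apply, derivative_sum, Units.smul_def, zsmul_eq_mul, derivative_intCast_mul,
    derivative_prod_finset]
  rw [Finset.sum_comm]
  refine Finset.sum_congr rfl fun σ _ => ?_
  rw [Finset.mul_sum]
  refine Finset.sum_congr rfl fun i _ => ?_
  rw [← Finset.prod_erase_mul _ _ (Finset.mem_univ i), updateCol_self]
  congr 2
  refine Finset.prod_congr rfl fun j hj => ?_
  rw [updateCol_ne (Finset.ne_of_mem_erase hj)]

/-- **Newton's identities** for the coefficients of the reversed characteristic polynomial. -/
theorem newton_charpolyRev (A : Matrix ι ι R) (j : ℕ) :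
    ((j : R) + 1) * A.charpolyRev.coeff (j + 1) =
      -∑ p ∈ Finset.HasAntidiagonal.antidiagonal j,
        A.charpolyRev.coeff p.1 * (A ^ (p.2 + 1)).trace := by
  set N : Matrix ι ι R[X] := 1 - (X : R[X]) • A.map C with hN
  have hD : A.charpolyRev = N.det := rfl
  let B : ℕ → Matrix ι ι R := fun j => N.adjugate.map fun p => p.coeff j
  have hcoeff : ∀ j, (N.adjugate * A.map C).map (fun p => p.coeff j) = B j * A := by
    intro j
    ext a b
    simp [B, Matrix.mul_apply]
  have hadj : N.adjugate - (X : R[X]) • (N.adjugate * A.map C) = A.charpolyRev • 1 := by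
    rw [hD, ← adjugate_mul, hN, Matrix.mul_sub, Matrix.mul_one, Matrix.mul_smul]
  -- The coefficients of the adjugate of `1 - XA`, obtained by comparing powers of `X` in `adj(1 -
  -- XA) (1 - XA) = det(1 - XA)`. Jacobi's formula then turns them into traces.
  have hB : ∀ j, B j = ∑ p ∈ Finset.HasAntidiagonal.antidiagonal j,
      A.charpolyRev.coeff p.1 • A ^ p.2 := by
    intro j
    induction j with
    | zero =>
      ext a b
      have := congrArg (fun p => p.coeff 0) (congrFun (congrFun hadj a) b)
      simpa [B, Matrix.one_apply, apply_ite (fun p : R[X] => p.coeff 0)] using this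
    | succ j ih =>
      have h1 : B (j + 1) = B j * A + A.charpolyRev.coeff (j + 1) • 1 := by
        ext a b
        have h2 := congrArg (fun p => p.coeff (j + 1)) (congrFun (congrFun hadj a) b)
        have h3 := congrFun (congrFun (hcoeff j) a) b
        simp only [Matrix.sub_apply, Matrix.smul_apply, smul_eq_mul, coeff_sub, coeff_X_mul,
          Matrix.one_apply, mul_ite, mul_one, mul_zero, apply_ite (fun p : R[X] => p.coeff (j + 1)),
          coeff_zero, map_apply] at h2 h3
        rw [h3, sub_eq_iff_eq_add] at h2
        simp only [B, map_apply, Matrix.add_apply, Matrix.smul_apply, Matrix.one_apply, smul_eq_mul,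
          mul_ite, mul_one, mul_zero]
        rw [h2, add_comm]
      rw [h1, ih, Finset.Nat.sum_antidiagonal_succ', Finset.sum_mul, add_comm]
      simp [pow_succ]
  have hder := congrArg (fun p => p.coeff j) (derivative_det_eq_trace N)
  have hmap : N.map derivative = -A.map C := by
    ext1 a b
    simp [hN, Matrix.one_apply, apply_ite derivative]
  simp only [hmap, Matrix.mul_neg, Matrix.trace_neg, coeff_neg, coeff_derivative, ← hD] at hder
  have htr : (N.adjugate * A.map C).trace.coeff j = (B j * A).trace := by
    rw [← hcoeff, Matrix.trace, Matrix.trace, finsetSum_coeff]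
    rfl
  rw [htr, hB, Finset.sum_mul, Matrix.trace_sum] at hder
  rw [mul_comm, hder]
  simp [pow_succ]

theorem charpoly_coeff_eq_charpolyRev [Nontrivial R] (A : Matrix ι ι R) {i : ℕ}
    (hi : i ≤ Fintype.card ι) :
    A.charpoly.coeff i = A.charpolyRev.coeff (Fintype.card ι - i) := by
  rw [← reverse_charpoly, coeff_reverse, charpoly_natDegree_eq_dim, revAt_le (Nat.sub_le _ _)]
  congr 1
  omega

/-- **Cayley–Hamilton** as a linear recurrence for the powers of a matrix. -/
theorem pow_card_add_eq [Nontrivial R] (A : Matrix ι ι R) (k : ℕ) :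
    A ^ (Fintype.card ι + k) = -∑ i ∈ Finset.range (Fintype.card ι),
      A.charpolyRev.coeff (Fintype.card ι - i) • A ^ (i + k) := by
  have h := A.aeval_self_charpoly
  rw [aeval_eq_sum_range, charpoly_natDegree_eq_dim, Finset.sum_range_succ] at h
  have hlead : A.charpoly.coeff (Fintype.card ι) = 1 := by
    rw [← charpoly_natDegree_eq_dim A]; exact A.charpoly_monic
  rw [hlead, one_smul] at h
  rw [pow_add, eq_neg_of_add_eq_zero_right h, neg_mul, Finset.sum_mul]
  congr 1
  refine Finset.sum_congr rfl fun i hi => ?_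
  rw [charpoly_coeff_eq_charpolyRev A (Finset.mem_range.mp hi).le, smul_mul_assoc, ← pow_add]

end Newton

/-! ### Bounding the exponent by `n - 1`. -/

section Reduction

variable {n m : ℕ}

/-- The matrix `w w̄`. -/
def wMulBar (x : T n m) : Matrix (Fin n) (Fin n) ℂ :=
  (x.1 : Matrix (Fin n) (Fin n) ℂ) * bar (x.1 : Matrix (Fin n) (Fin n) ℂ)

variable {A : Subalgebra ℂ (T n m → ℂ)}

/-- Newton's identities can be solved for the coefficient, as `j + 1` is invertible in `ℂ`; for `j ≤
n` they involve only the traces of the powers `1, …, n`. -/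
theorem charpolyRev_coeff_mem (hA : ∀ k < n, phi (k + 1) ∈ A) {j : ℕ} (hj : j ≤ n) :
    (fun x => (wMulBar x).charpolyRev.coeff j) ∈ A := by
  induction j using Nat.strong_induction_on with
  | _ j ih =>
    rcases j with _ | j
    · convert A.one_mem using 1
      ext x
      rw [Polynomial.coeff_zero_eq_eval_zero, eval_charpolyRev]
      rfl
    · have h : (fun x : T n m => (wMulBar x).charpolyRev.coeff (j + 1)) =
          (-((j : ℂ) + 1)⁻¹) • ∑ p ∈ Finset.HasAntidiagonal.antidiagonal j,
            (fun x : T n m => (wMulBar x).charpolyRev.coeff p.1) * phi (p.2 + 1) := by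
        ext x
        have h1 := newton_charpolyRev (wMulBar x) j
        have h2 : (j : ℂ) + 1 ≠ 0 := Nat.cast_add_one_ne_zero j
        simp only [Pi.smul_apply, Finset.sum_apply, Pi.mul_apply, smul_eq_mul]
        rw [neg_mul, ← mul_neg, eq_inv_mul_iff_mul_eq₀ h2, h1]
        rfl
      rw [h]
      refine Subalgebra.smul_mem _ (sum_mem fun p hp => mul_mem ?_ ?_) _
      · have := Finset.HasAntidiagonal.mem_antidiagonal.mp hp
        exact ih _ (by omega) (by omega)
      · have := Finset.HasAntidiagonal.mem_antidiagonal.mp hp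
        exact hA _ (by omega)

/-- Applying `L x` to Cayley–Hamilton expresses `f (n + k)` through the `n` preceding terms, with
coefficients already in `A`. -/
theorem mem_of_linear_recurrence (hA : ∀ k < n, phi (k + 1) ∈ A) (f : ℕ → T n m → ℂ)
    (L : T n m → Matrix (Fin n) (Fin n) ℂ →ₗ[ℂ] ℂ) (hf : ∀ k x, f k x = L x (wMulBar x ^ k))
    (hfA : ∀ k < n, f k ∈ A) (k : ℕ) : f k ∈ A := by
  induction k using Nat.strong_induction_on with
  | _ k ih =>
    by_cases hk : k < n
    · exact hfA k hk
    obtain ⟨k, rfl⟩ := Nat.exists_eq_add_of_le (not_lt.mp hk)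
    have h : f (n + k) = -∑ i ∈ Finset.range n,
        (fun x => (wMulBar x).charpolyRev.coeff (n - i)) * f (i + k) := by
      ext x
      have := pow_card_add_eq (wMulBar x) k
      rw [Fintype.card_fin] at this
      simp [hf, this]
    rw [h]
    refine neg_mem (sum_mem fun i hi => mul_mem (charpolyRev_coeff_mem hA (Nat.sub_le _ _)) ?_)
    exact ih _ (by have := Finset.mem_range.mp hi; omega)

theorem fullAlg_le_adjoin_complexGenerators :
    fullAlg n m ≤ Algebra.adjoin ℂ (complexGenerators n m) := by
  have hphi : ∀ k < n, (phi (k + 1) : T n m → ℂ) ∈ Algebra.adjoin ℂ (complexGenerators n m) :=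
    fun k hk => Algebra.subset_adjoin (Or.inl (Or.inl (Or.inl ⟨k, hk, rfl⟩)))
  have hent : ∀ (f : ℕ → T n m → ℂ) (P Q : T n m → Matrix (Fin m) (Fin n) ℂ) (b a : Fin m),
      (∀ k x, f k x = (P x * wMulBar x ^ k * (Q x)ᵀ) b a) →
      (∀ k < n, f k ∈ Algebra.adjoin ℂ (complexGenerators n m)) →
      ∀ k, f k ∈ Algebra.adjoin ℂ (complexGenerators n m) := by
    intro f P Q b a hf
    refine mem_of_linear_recurrence hphi f (fun x =>
      { toFun := fun M => (P x * M * (Q x)ᵀ) b a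
        map_add' := fun M N => by rw [Matrix.mul_add, Matrix.add_mul]; rfl
        map_smul' := fun c M => by rw [Matrix.mul_smul, Matrix.smul_mul]; rfl }) hf
  refine Algebra.adjoin_le ?_
  rintro f (((⟨k, rfl⟩ | ⟨k, a, b, rfl⟩) | ⟨k, a, b, rfl⟩) | ⟨k, a, b, rfl⟩)
  · rcases k with _ | k
    · convert! Subalgebra.algebraMap_mem (Algebra.adjoin ℂ (complexGenerators n m)) (n : ℂ) using 1
      ext x
      simp [phi]
    -- The shifted sequence `k ↦ phi (k + 1)` is used, with the functional `M ↦ tr (M w w̄)`, so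
    -- that its first `n` terms are exactly the trace generators.
    · refine mem_of_linear_recurrence hphi (fun k => phi (k + 1)) (fun x =>
        Matrix.traceLinearMap (Fin n) ℂ ℂ ∘ₗ LinearMap.mulRight ℂ (wMulBar x))
        (fun k x => ?_) hphi k
      simp [phi, wMulBar, pow_succ, Matrix.mul_assoc]
  · exact hent (fun k => psi00 k b a) (fun x => bar x.2) (fun x => x.2) b a (fun _ _ => rfl)
      (fun k hk => Algebra.subset_adjoin (Or.inl (Or.inl (Or.inr ⟨k, hk, a, b, rfl⟩)))) k
  · refine hent (fun k => psi01 k b a) (fun x => bar x.2)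
      (fun x => bar x.2 * (x.1 : Matrix (Fin n) (Fin n) ℂ)) b a (fun k x => ?_)
      (fun k hk => Algebra.subset_adjoin (Or.inl (Or.inr ⟨k, hk, a, b, rfl⟩))) k
    rw [transpose_mul, SymMat.transpose_eq, ← Matrix.mul_assoc]
    rfl
  · exact hent (fun k => psi10 k b a)
      (fun x => x.2 * bar (x.1 : Matrix (Fin n) (Fin n) ℂ)) (fun x => x.2) b a (fun _ _ => rfl)
      (fun k hk => Algebra.subset_adjoin (Or.inr ⟨k, hk, a, b, rfl⟩)) k

end Reduction

variable {n m : ℕ}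

/-! ### The generators are invariant polynomials. -/

section Membership

theorem coord_mem_Pol (t : CoordType m) (I : Fin t.arity → Fin n) : t.coord I ∈ Pol ℂ (T n m) := by
  have hz : ∀ a i, (fun x : T n m => x.2 a i) ∈ Pol ℂ (T n m) := fun a i =>
    Algebra.subset_adjoin ⟨(Matrix.entryLinearMap ℝ ℂ a i) ∘ₗ LinearMap.snd ℝ _ _, rfl⟩
  have hw : ∀ i j, (fun x : T n m => (x.1 : Matrix (Fin n) (Fin n) ℂ) i j) ∈ Pol ℂ (T n m) :=
    fun i j => Algebra.subset_adjoin ⟨(Matrix.entryLinearMap ℝ ℂ i j) ∘ₗ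
      (SymMat n).subtype.restrictScalars ℝ ∘ₗ LinearMap.fst ℝ _ _, rfl⟩
  have hzb : ∀ a i, (fun x : T n m => bar x.2 a i) ∈ Pol ℂ (T n m) := fun a i =>
    Algebra.subset_adjoin ⟨Complex.conjAe.toLinearMap ∘ₗ (Matrix.entryLinearMap ℝ ℂ a i) ∘ₗ
      LinearMap.snd ℝ _ _, rfl⟩
  have hwb : ∀ i j, (fun x : T n m => bar (x.1 : Matrix (Fin n) (Fin n) ℂ) i j) ∈ Pol ℂ (T n m) :=
    fun i j => Algebra.subset_adjoin ⟨Complex.conjAe.toLinearMap ∘ₗ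
      (Matrix.entryLinearMap ℝ ℂ i j) ∘ₗ
      (SymMat n).subtype.restrictScalars ℝ ∘ₗ LinearMap.fst ℝ _ _, rfl⟩
  cases t with
  | w => exact hw _ _
  | wBar => exact hwb _ _
  | z a => exact hz _ _
  | zBar a => exact hzb _ _

/-- Matrix-valued functions with entries in a subalgebra. -/
theorem mul_entries_mem {V p q r : Type*} [Fintype q] {A : Subalgebra ℂ (V → ℂ)}
    {X : V → Matrix p q ℂ} {Y : V → Matrix q r ℂ}
    (hX : ∀ i j, (fun x => X x i j) ∈ A) (hY : ∀ i j, (fun x => Y x i j) ∈ A) (i : p) (j : r) :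
    (fun x => (X x * Y x) i j) ∈ A := by
  have : (fun x => (X x * Y x) i j) = ∑ k, (fun x => X x i k) * fun x => Y x k j := by
    ext x
    simp [Matrix.mul_apply]
  rw [this]
  exact sum_mem fun k _ => mul_mem (hX i k) (hY k j)

theorem pow_entries_mem {V q : Type*} [Fintype q] [DecidableEq q] {A : Subalgebra ℂ (V → ℂ)}
    {X : V → Matrix q q ℂ} (hX : ∀ i j, (fun x => X x i j) ∈ A) (k : ℕ) (i j : q) :
    (fun x => (X x ^ k) i j) ∈ A := by
  induction k generalizing i j with
  | zero =>
    simp only [pow_zero]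
    exact A.algebraMap_mem ((1 : Matrix q q ℂ) i j)
  | succ k ih =>
    simp only [pow_succ]
    exact mul_entries_mem ih hX i j

theorem bar_mul {p q r : Type*} [Fintype q] (A : Matrix p q ℂ) (B : Matrix q r ℂ) :
    bar (A * B) = bar A * bar B := Matrix.map_mul

theorem bar_pow {q : Type*} [Fintype q] [DecidableEq q] (A : Matrix q q ℂ) (k : ℕ) :
    bar (A ^ k) = bar A ^ k := map_pow (starRingEnd ℂ).mapMatrix A k

theorem bar_bar {p q : Type*} (A : Matrix p q ℂ) : bar (bar A) = A := by
  ext; simp [bar]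

variable (h : unitaryGroup (Fin n) ℂ) (x : T n m)

/-- The inner factors cancel because `ᵗh h̄ = 1`, so `w w̄` is conjugated by `h`. -/
theorem act_wMulBar : wMulBar (act h x) =
    (h : Matrix (Fin n) (Fin n) ℂ) * wMulBar x * star (h : Matrix (Fin n) (Fin n) ℂ) := by
  have hh : (h : Matrix (Fin n) (Fin n) ℂ)ᵀ * bar h = 1 := by
    have := congrArg transpose (mem_unitaryGroup_iff'.mp h.2)
    rwa [transpose_mul, transpose_one] at this
  simp only [wMulBar, act, bar_mul]
  change _ * _ * _ * (_ * _ * star (h : Matrix (Fin n) (Fin n) ℂ)) = _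
  simp only [Matrix.mul_assoc]
  rw [← Matrix.mul_assoc _ (bar (h : Matrix (Fin n) (Fin n) ℂ)), hh, Matrix.one_mul]

theorem act_wMulBar_pow (k : ℕ) : wMulBar (act h x) ^ k =
    (h : Matrix (Fin n) (Fin n) ℂ) * wMulBar x ^ k * star (h : Matrix (Fin n) (Fin n) ℂ) := by
  have h1 := mem_unitaryGroup_iff'.mp h.2
  induction k with
  | zero => simp [mem_unitaryGroup_iff.mp h.2]
  | succ k ih =>
    rw [pow_succ, ih, act_wMulBar, pow_succ]
    simp only [Matrix.mul_assoc]
    rw [← Matrix.mul_assoc (star _), h1, Matrix.one_mul]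

theorem act_snd_transpose :
    (act h x).2ᵀ = (h : Matrix (Fin n) (Fin n) ℂ) * x.2ᵀ := by
  rw [act, transpose_mul, transpose_transpose]

theorem bar_act_snd : bar (act h x).2 = bar x.2 * star (h : Matrix (Fin n) (Fin n) ℂ) :=
  bar_mul _ _

theorem bar_act_fst : bar ((act h x).1 : Matrix (Fin n) (Fin n) ℂ) =
    bar (h : Matrix (Fin n) (Fin n) ℂ) * bar (x.1 : Matrix (Fin n) (Fin n) ℂ) *
      star (h : Matrix (Fin n) (Fin n) ℂ) := by
  simp only [act, bar_mul]
  rfl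

theorem complexGenerators_subset_PolInv : complexGenerators n m ⊆ PolInv ℂ n m := by
  have hw : ∀ i j, (fun x : T n m => (x.1 : Matrix (Fin n) (Fin n) ℂ) i j) ∈ Pol ℂ (T n m) :=
    fun i j => coord_mem_Pol .w ![i, j]
  have hwb : ∀ i j, (fun x : T n m => bar (x.1 : Matrix (Fin n) (Fin n) ℂ) i j) ∈ Pol ℂ (T n m) :=
    fun i j => coord_mem_Pol .wBar ![i, j]
  have hz : ∀ i j, (fun x : T n m => x.2 i j) ∈ Pol ℂ (T n m) :=
    fun i j => coord_mem_Pol (.z i) ![j]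
  have hzb : ∀ i j, (fun x : T n m => bar x.2 i j) ∈ Pol ℂ (T n m) :=
    fun i j => coord_mem_Pol (.zBar i) ![j]
  have hpow := fun k => pow_entries_mem (mul_entries_mem hw hwb) k
  have hstar : ∀ (h : unitaryGroup (Fin n) ℂ),
      star (h : Matrix (Fin n) (Fin n) ℂ) * h = 1 := fun h => mem_unitaryGroup_iff'.mp h.2
  have hbar : ∀ (h : unitaryGroup (Fin n) ℂ),
      (h : Matrix (Fin n) (Fin n) ℂ)ᵀ * bar h = 1 := fun h => by
    have := congrArg transpose (hstar h)
    rwa [transpose_mul, transpose_one] at this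
  have hstar' : ∀ (h : unitaryGroup (Fin n) ℂ) {p : Type} (M : Matrix (Fin n) p ℂ),
      star (h : Matrix (Fin n) (Fin n) ℂ) * ((h : Matrix (Fin n) (Fin n) ℂ) * M) = M :=
    fun h _ M => by rw [← Matrix.mul_assoc, hstar, Matrix.one_mul]
  have hbar' : ∀ (h : unitaryGroup (Fin n) ℂ) {p : Type} (M : Matrix (Fin n) p ℂ),
      (h : Matrix (Fin n) (Fin n) ℂ)ᵀ * (bar (h : Matrix (Fin n) (Fin n) ℂ) * M) = M :=
    fun h _ M => by rw [← Matrix.mul_assoc, hbar, Matrix.one_mul]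
  rintro f (((⟨k, -, rfl⟩ | ⟨k, -, a, b, rfl⟩) | ⟨k, -, a, b, rfl⟩) | ⟨k, -, a, b, rfl⟩)
  · constructor
    · have : (phi (k + 1) : T n m → ℂ) = ∑ i, fun x => (wMulBar x ^ (k + 1)) i i := by
        ext x; simp [phi, wMulBar, Matrix.trace]
      rw [this]
      exact sum_mem fun i _ => hpow _ i i
    · intro h x
      change (wMulBar (act h x) ^ (k + 1)).trace = (wMulBar x ^ (k + 1)).trace
      rw [act_wMulBar_pow, trace_mul_cycle, hstar, Matrix.one_mul]
  · constructor
    · exact mul_entries_mem (mul_entries_mem hzb (hpow k)) (fun i j => hz j i) b a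
    · intro h x
      change (bar (act h x).2 * wMulBar (act h x) ^ k * (act h x).2ᵀ) b a =
        (bar x.2 * wMulBar x ^ k * x.2ᵀ) b a
      simp only [act_wMulBar_pow, bar_act_snd, act_snd_transpose, Matrix.mul_assoc, hstar']
  · constructor
    · exact mul_entries_mem (mul_entries_mem (mul_entries_mem hzb (hpow k)) hw)
        (fun i j => hzb j i) b a
    · intro h x
      change (bar (act h x).2 * wMulBar (act h x) ^ k *
        ((h : Matrix (Fin n) (Fin n) ℂ) * (x.1 : Matrix (Fin n) (Fin n) ℂ) *
          (h : Matrix (Fin n) (Fin n) ℂ)ᵀ) *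
        bar (act h x).2ᵀ) b a =
          (bar x.2 * wMulBar x ^ k * (x.1 : Matrix (Fin n) (Fin n) ℂ) * bar x.2ᵀ) b a
      simp only [act_wMulBar_pow, bar_act_snd, act_snd_transpose, bar_mul, Matrix.mul_assoc,
        hstar', hbar']
  · constructor
    · exact mul_entries_mem (mul_entries_mem (mul_entries_mem hz hwb) (hpow k))
        (fun i j => hz j i) b a
    · intro h x
      change (x.2 * (h : Matrix (Fin n) (Fin n) ℂ)ᵀ *
        bar ((act h x).1 : Matrix (Fin n) (Fin n) ℂ) * wMulBar (act h x) ^ k * (act h x).2ᵀ) b a =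
          (x.2 * bar (x.1 : Matrix (Fin n) (Fin n) ℂ) * wMulBar x ^ k * x.2ᵀ) b a
      simp only [act_wMulBar_pow, bar_act_fst, act_snd_transpose, Matrix.mul_assoc, hstar', hbar']

theorem adjoin_complexGenerators :
    Algebra.adjoin ℂ (complexGenerators n m) = PolInv ℂ n m :=
  le_antisymm (Algebra.adjoin_le complexGenerators_subset_PolInv)
    (PolInv_le_fullAlg.trans fullAlg_le_adjoin_complexGenerators)

end Membership

/-! ### Real-valued generators. -/

section RealForm

/-- The complex-valued functions underlying a set of real-valued functions. -/
def ofRealSet {V : Type*} (S : Set (V → ℝ)) : Set (V → ℂ) :=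
  {f | ∃ g ∈ S, f = fun x => (g x : ℂ)}

/-- The functions whose real and imaginary parts lie in a real algebra form a complex algebra, so
checking generators suffices. -/
theorem re_im_mem_adjoin {V : Type*} {S : Set (V → ℂ)} {A : Subalgebra ℝ (V → ℝ)}
    (hS : ∀ f ∈ S, (fun x => (f x).re) ∈ A ∧ (fun x => (f x).im) ∈ A) {f : V → ℂ}
    (hf : f ∈ Algebra.adjoin ℂ S) : (fun x => (f x).re) ∈ A ∧ (fun x => (f x).im) ∈ A := by
  induction hf using Algebra.adjoin_induction with
  | mem f hf => exact hS f hf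
  | algebraMap r => exact ⟨A.algebraMap_mem r.re, A.algebraMap_mem r.im⟩
  | add f g _ _ hf hg => exact ⟨add_mem hf.1 hg.1, add_mem hf.2 hg.2⟩
  | mul f g _ _ hf hg =>
    exact ⟨sub_mem (mul_mem hf.1 hg.1) (mul_mem hf.2 hg.2),
      add_mem (mul_mem hf.1 hg.2) (mul_mem hf.2 hg.1)⟩

theorem re_mem_PolInv {f : T n m → ℂ} (hf : f ∈ PolInv ℂ n m) :
    (fun x => (f x).re) ∈ PolInv ℝ n m ∧ (fun x => (f x).im) ∈ PolInv ℝ n m := by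
  obtain ⟨hf, hinv⟩ := hf
  have h := re_im_mem_adjoin (A := Pol ℝ (T n m)) (by
    rintro _ ⟨l, rfl⟩
    exact ⟨Algebra.subset_adjoin ⟨Complex.reLm ∘ₗ l, rfl⟩,
      Algebra.subset_adjoin ⟨Complex.imLm ∘ₗ l, rfl⟩⟩) hf
  exact ⟨⟨h.1, fun g x => congrArg Complex.re (hinv g x)⟩,
    ⟨h.2, fun g x => congrArg Complex.im (hinv g x)⟩⟩

theorem ofReal_mem_PolInv {g : T n m → ℝ} (hg : g ∈ PolInv ℝ n m) :
    (fun x => (g x : ℂ)) ∈ PolInv ℂ n m := by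
  obtain ⟨hg, hinv⟩ := hg
  refine ⟨?_, fun h x => congrArg Complex.ofReal (hinv h x)⟩
  clear hinv
  induction hg using Algebra.adjoin_induction with
  | mem g hg =>
    obtain ⟨l, rfl⟩ := hg
    exact Algebra.subset_adjoin ⟨Complex.ofRealCLM.toLinearMap ∘ₗ l, rfl⟩
  | algebraMap r => exact (Pol ℂ (T n m)).algebraMap_mem (r : ℂ)
  | add f g _ _ hf hg =>
    simp only [Pi.add_apply, Complex.ofReal_add]
    exact add_mem hf hg
  | mul f g _ _ hf hg =>
    simp only [Pi.mul_apply, Complex.ofReal_mul]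
    exact mul_mem hf hg

theorem psi00_conj (k : ℕ) (a b : Fin m) (x : T n m) :
    starRingEnd ℂ (psi00 k a b x) = psi00 k b a x := by
  have h1 := SymMat.transpose_eq x.1
  have h2 := SymMat.bar_transpose_eq x.1
  change bar (bar x.2 * wMulBar x ^ k * x.2ᵀ) a b = (bar x.2 * wMulBar x ^ k * x.2ᵀ) b a
  rw [← transpose_apply (bar x.2 * wMulBar x ^ k * x.2ᵀ)]
  simp only [wMulBar, bar_mul, bar_pow, bar_bar, transpose_mul, transpose_pow, h1, h2,
    transpose_transpose, Matrix.mul_assoc]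
  rfl

theorem psi10_symm (k : ℕ) (a b : Fin m) : (psi10 k a b : T n m → ℂ) = psi10 k b a := by
  ext x
  have h1 := SymMat.transpose_eq x.1
  have h2 := SymMat.bar_transpose_eq x.1
  refine congrFun (congrFun (?_ : x.2 * bar (x.1 : Matrix (Fin n) (Fin n) ℂ) *
    ((x.1 : Matrix (Fin n) (Fin n) ℂ) * bar (x.1 : Matrix (Fin n) (Fin n) ℂ)) ^ k * x.2ᵀ =
      (x.2 * bar (x.1 : Matrix (Fin n) (Fin n) ℂ) * ((x.1 : Matrix (Fin n) (Fin n) ℂ) *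
        bar (x.1 : Matrix (Fin n) (Fin n) ℂ)) ^ k * x.2ᵀ)ᵀ) a) b
  simp only [transpose_mul, transpose_pow, h1, h2, transpose_transpose, Matrix.mul_assoc]
  rw [← Matrix.mul_assoc _ _ x.2ᵀ, ← mul_pow_mul, Matrix.mul_assoc]

theorem psi10_conj (k : ℕ) (a b : Fin m) (x : T n m) :
    starRingEnd ℂ (psi10 k a b x) = psi01 k a b x := by
  refine congrFun (congrFun (?_ : bar (x.2 * bar (x.1 : Matrix (Fin n) (Fin n) ℂ) *
    wMulBar x ^ k * x.2ᵀ) = bar x.2 * wMulBar x ^ k * (x.1 : Matrix (Fin n) (Fin n) ℂ) *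
      (bar x.2)ᵀ) a) b
  simp only [wMulBar, bar_mul, bar_pow, bar_bar, Matrix.mul_assoc]
  rw [← Matrix.mul_assoc _ (x.1 : Matrix (Fin n) (Fin n) ℂ) (bar x.2)ᵀ, mul_pow_mul,
    Matrix.mul_assoc]
  rfl

theorem realGenerators_subset_PolInv : realGenerators n m ⊆ PolInv ℝ n m := by
  have h00 : ∀ k < n, ∀ a b : Fin m, psi00 k a b ∈ PolInv ℂ n m := fun k hk a b =>
    complexGenerators_subset_PolInv (Or.inl (Or.inl (Or.inr ⟨k, hk, b, a, rfl⟩)))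
  have h10 : ∀ k < n, ∀ a b : Fin m, psi10 k a b ∈ PolInv ℂ n m := fun k hk a b =>
    complexGenerators_subset_PolInv (Or.inr ⟨k, hk, b, a, rfl⟩)
  rintro f ((((⟨k, hk, rfl⟩ | ⟨k, hk, a, b, -, rfl⟩) | ⟨k, hk, a, b, -, rfl⟩) |
    ⟨k, hk, a, b, -, rfl⟩) | ⟨k, hk, a, b, -, rfl⟩)
  · exact (re_mem_PolInv (complexGenerators_subset_PolInv
      (Or.inl (Or.inl (Or.inl ⟨k, hk, rfl⟩))))).1
  · exact (re_mem_PolInv (h00 k hk a b)).1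
  · exact (re_mem_PolInv (h00 k hk a b)).2
  · exact (re_mem_PolInv (h10 k hk a b)).1
  · exact (re_mem_PolInv (h10 k hk a b)).2

theorem complexGenerators_subset_adjoin_real :
    complexGenerators n m ⊆ Algebra.adjoin ℂ (ofRealSet (realGenerators n m)) := by
  set A := Algebra.adjoin ℂ (ofRealSet (realGenerators n m)) with hA
  have hgen : ∀ g ∈ realGenerators n m, (fun x => (g x : ℂ)) ∈ A := fun g hg =>
    Algebra.subset_adjoin ⟨g, hg, rfl⟩
  have hcomb : ∀ f : T n m → ℂ, (fun x => ((f x).re : ℂ)) ∈ A → (fun x => ((f x).im : ℂ)) ∈ A →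
      f ∈ A ∧ (fun x => starRingEnd ℂ (f x)) ∈ A := by
    intro f hr hi
    constructor
    · convert add_mem hr (A.smul_mem hi Complex.I) using 1
      ext x
      simp [mul_comm Complex.I]
    · convert sub_mem hr (A.smul_mem hi Complex.I) using 1
      ext x
      apply Complex.ext <;> simp
  have h00 : ∀ k < n, ∀ a b : Fin m, a ≤ b → psi00 k a b ∈ A ∧ psi00 k b a ∈ A := by
    intro k hk a b hab
    simp only [← funext (psi00_conj k a b)]
    refine hcomb _ (hgen _ (Or.inl (Or.inl (Or.inl (Or.inr ⟨k, hk, a, b, hab, rfl⟩))))) ?_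
    rcases hab.lt_or_eq with hab | rfl
    · exact hgen _ (Or.inl (Or.inl (Or.inr ⟨k, hk, a, b, hab, rfl⟩)))
    -- The diagonal entries of a Hermitian matrix are real, which is why `Im ψ^{(0,2k,0)}` is only
    -- listed for `c < d`.
    · have : ∀ x : T n m, (psi00 k a a x).im = 0 := fun x =>
        Complex.conj_eq_iff_im.mp (psi00_conj k a a x)
      simp only [this, Complex.ofReal_zero]
      exact zero_mem A
  have h10' : ∀ k < n, ∀ a b : Fin m, a ≤ b → psi10 k a b ∈ A ∧ psi01 k a b ∈ A := by
    intro k hk a b hab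
    rw [← funext (psi10_conj k a b)]
    exact hcomb _ (hgen _ (Or.inl (Or.inr ⟨k, hk, a, b, hab, rfl⟩)))
      (hgen _ (Or.inr ⟨k, hk, a, b, hab, rfl⟩))
  have h10 : ∀ k < n, ∀ a b : Fin m, psi10 k a b ∈ A ∧ psi01 k a b ∈ A := by
    intro k hk a b
    rcases le_total a b with hab | hab
    · exact h10' k hk a b hab
    · rw [← funext (psi10_conj k a b), psi10_symm k a b, funext (psi10_conj k b a)]
      exact h10' k hk b a hab
  rintro f (((⟨k, hk, rfl⟩ | ⟨k, hk, a, b, rfl⟩) | ⟨k, hk, a, b, rfl⟩) | ⟨k, hk, a, b, rfl⟩)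
  · have h : (phi (k + 1) : T n m → ℂ) = fun x => ((phi (k + 1) x).re : ℂ) :=
      funext fun x => Complex.ext (by simp) (by simp [phi_im])
    rw [h]
    exact hgen _ (Or.inl (Or.inl (Or.inl (Or.inl ⟨k, hk, rfl⟩))))
  · rcases le_total a b with hab | hab
    · exact (h00 k hk a b hab).2
    · exact (h00 k hk b a hab).1
  · exact (h10 k hk b a).2
  · exact (h10 k hk b a).1

theorem adjoin_ofReal_realGenerators :
    Algebra.adjoin ℂ (ofRealSet (realGenerators n m)) = PolInv ℂ n m := by
  refine le_antisymm (Algebra.adjoin_le ?_) ?_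
  · rintro _ ⟨g, hg, rfl⟩
    exact ofReal_mem_PolInv (realGenerators_subset_PolInv hg)
  · rw [← adjoin_complexGenerators]
    exact Algebra.adjoin_le complexGenerators_subset_adjoin_real

theorem adjoin_realGenerators : Algebra.adjoin ℝ (realGenerators n m) = PolInv ℝ n m := by
  refine le_antisymm (Algebra.adjoin_le realGenerators_subset_PolInv) fun g hg => ?_
  have h := ofReal_mem_PolInv hg
  rw [← adjoin_ofReal_realGenerators] at h
  -- The real invariant, viewed as complex-valued, is a complex polynomial in the real generators;
  -- its real part is a real polynomial in them, and equals the invariant.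
  refine (re_im_mem_adjoin (A := Algebra.adjoin ℝ (realGenerators n m)) ?_ h).1
  rintro _ ⟨g, hg, rfl⟩
  refine ⟨Algebra.subset_adjoin hg, ?_⟩
  simp only [Complex.ofReal_im]
  exact zero_mem (Algebra.adjoin ℝ (realGenerators n m))

end RealForm

end SiegelJacobi

end

theorem theorem3p3 (n m : ℕ) :
    Algebra.adjoin ℂ (SiegelJacobi.complexGenerators n m) = SiegelJacobi.PolInv ℂ n m ∧
    Algebra.adjoin ℂ {f : SiegelJacobi.T n m → ℂ |
      ∃ g ∈ SiegelJacobi.realGenerators n m, f = fun x => (g x : ℂ)} =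
        SiegelJacobi.PolInv ℂ n m ∧
    Algebra.adjoin ℝ (SiegelJacobi.realGenerators n m) = SiegelJacobi.PolInv ℝ n m :=
  ⟨SiegelJacobi.adjoin_complexGenerators, SiegelJacobi.adjoin_ofReal_realGenerators,
    SiegelJacobi.adjoin_realGenerators⟩
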